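/- Let $P=\langle X\mid R\rangle$ be a finite group presentation, i.e. $X$ is a finite set and $R$ a finite set of group words over $X$. An \emph{annular diagram} over $P$ is a finite connected graph drawn on the oriented sphere, with edges labeled by letters of $X^{\pm1}$ (reversing an edge inverts its label), together with two distinct faces, called holes, such that the contour of every other face, called a \emph{cell}, has as its label, read from a suitable vertex, a word of $R^{\pm1}$. The contours $p$ and $p'$ of the two holes are the boundary components; their labels are cyclic words. The diagram is \emph{proper} if $p$ and $p'$ are disjoint simple closed curves, so that it tessellates an actual annulus; in general the contours may touch themselves or each other. The \emph{area} of a diagram is the number of its cells. A diagram is \emph{minimal} if it has the smallest area among all annular diagrams over $P$ whose inner and outer boundary components have the same labels as its own; a proper diagram is also called minimal if it has the smallest area among all proper annular diagrams over $P$ with the same boundary labels. Then there is a constant $C>0$, depending only on $P$, such that for every annular diagram $\Delta$ over $P$ that is minimal in either of these two senses, and for every shortest path $x$ in the graph of $\Delta$ connecting a vertex of $p$ with a vertex of $p'$, the area of $\Delta$ is at least $C\,|x|\log|x|$. Here $|x|$ is the number of edges of $x$, and $0\log 0=0$. -/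

import Mathlib

/-- A group word over the alphabet `X`: the letter `(a, true)` is `a`, the letter `(a, false)` is
`a⁻¹`. Words are not reduced. The formal inverse of a word is `FreeGroup.invRev`. -/
abbrev GroupWord (X : Type*) : Type _ := List (X × Bool)

/-- A finite connected graph (loops and multiple edges allowed) drawn on the oriented sphere, with at
least one edge, up to isotopy, given by its rotation system.

A dart is an edge with a direction; `rev` reverses the direction. The map `rot` sends a dart `d`
to the counterclockwise next dart with the same initial vertex. -/
structure SphereMap where
  /-- The oriented edges. -/
  Dart : Type
  finite_dart : Finite Dart
  nonempty_dart : Nonempty Dart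
  /-- The same edge with the opposite direction. -/
  rev : Equiv.Perm Dart
  rev_rev : ∀ d, rev (rev d) = d
  rev_ne : ∀ d, rev d ≠ d
  /-- Counterclockwise rotation about the initial vertex. -/
  rot : Equiv.Perm Dart
  /-- The graph is connected. -/
  connected : ∀ d e : Dart, ∃ g ∈ Subgroup.closure {rev, rot}, g d = e
  /-- Euler's formula `V + F = E + 2`: the surface carrying the graph is the sphere. The vertices,
  edges and faces are the orbits of `rot`, of `rev`, and of the permutation sending a dart to the
  next one along the face to its left. -/
  euler :
    Nat.card (Quotient (Equiv.Perm.SameCycle.setoid rot)) +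
      Nat.card (Quotient (Equiv.Perm.SameCycle.setoid (rot⁻¹ * rev))) =
    Nat.card (Quotient (Equiv.Perm.SameCycle.setoid rev)) + 2

namespace SphereMap

variable (M : SphereMap)

/-- The dart following `d` on the contour of the face to the left of `d`. -/
def next : Equiv.Perm M.Dart := M.rot⁻¹ * M.rev

/-- The vertices of the graph. -/
def Vertex : Type := Quotient (Equiv.Perm.SameCycle.setoid M.rot)

/-- The faces: the connected components of the complement of the graph in the sphere. -/
def Face : Type := Quotient (Equiv.Perm.SameCycle.setoid M.next)

/-- The initial vertex of an oriented edge. -/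
def tail (d : M.Dart) : M.Vertex := Quotient.mk _ d

/-- The terminal vertex of an oriented edge. -/
def head (d : M.Dart) : M.Vertex := M.tail (M.rev d)

/-- The face to the left of an oriented edge. -/
def face (d : M.Dart) : M.Face := Quotient.mk _ d

/-- The vertex `v` lies on the contour of the face `f`. -/
def OnContour (v : M.Vertex) (f : M.Face) : Prop := ∃ d, M.tail d = v ∧ M.face d = f

/-- `M.IsPath v w x`: the sequence `x` of oriented edges is a path from `v` to `w`. -/
def IsPath : M.Vertex → M.Vertex → List M.Dart → Prop
  | v, w, [] => v = w
  | v, w, d :: x => M.tail d = v ∧ IsPath (M.head d) w x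

end SphereMap

/-- An annular diagram over the presentation `⟨X | R⟩`: a labelled map on the sphere with two
distinct faces, the holes, removed; all remaining faces are cells, and the label of the contour of
a cell is, from a suitable starting vertex, a word of `R` or the inverse of one. The contours of the
holes may touch themselves or each other. -/
structure AnnularDiagram {X : Type*} (R : Set (GroupWord X)) extends SphereMap where
  /-- The label of an oriented edge. -/
  label : Dart → X × Bool
  label_rev : ∀ d, label (rev d) = ((label d).1, !(label d).2)
  /-- The hole bounded by the inner boundary component `p`. -/
  inner : toSphereMap.Face
  /-- The hole bounded by the outer boundary component `p'`. -/
  outer : toSphereMap.Face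
  inner_ne_outer : inner ≠ outer
  cell_label : ∀ d, toSphereMap.face d ≠ inner → toSphereMap.face d ≠ outer →
    ∃ r ∈ R,
      (Function.periodicOrbit toSphereMap.next d).map label = (r : Cycle (X × Bool)) ∨
      (Function.periodicOrbit toSphereMap.next d).map label =
        (FreeGroup.invRev r : Cycle (X × Bool))

namespace AnnularDiagram

variable {X : Type*} {R : Set (GroupWord X)} (Δ : AnnularDiagram R)

/-- The area: the number of cells. -/
noncomputable def area : ℕ := Nat.card {f : Δ.Face // f ≠ Δ.inner ∧ f ≠ Δ.outer}

/-- The cyclic word read along the contour of the face to the left of `d`. -/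
noncomputable def contourLabel (d : Δ.Dart) : Cycle (X × Bool) :=
  (Function.periodicOrbit Δ.next d).map Δ.label

/-- The inner boundary components of the two diagrams have the same label, and so do the outer
ones. Boundary labels are cyclic words, read with the hole on the left. -/
def SameBoundaryLabels (Δ' : AnnularDiagram R) : Prop :=
  (∀ d d', Δ.face d = Δ.inner → Δ'.face d' = Δ'.inner → Δ.contourLabel d = Δ'.contourLabel d') ∧
  (∀ d d', Δ.face d = Δ.outer → Δ'.face d' = Δ'.outer → Δ.contourLabel d = Δ'.contourLabel d')

/-- The two boundary components are disjoint simple closed curves, so that the diagram tessellates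
an actual annulus. -/
def IsProper : Prop :=
  (∀ d e, Δ.face d = Δ.inner → Δ.face e = Δ.inner → Δ.tail d = Δ.tail e → d = e) ∧
  (∀ d e, Δ.face d = Δ.outer → Δ.face e = Δ.outer → Δ.tail d = Δ.tail e → d = e) ∧
  ∀ v, ¬ (Δ.OnContour v Δ.inner ∧ Δ.OnContour v Δ.outer)

/-- The diagram has the smallest area among all annular diagrams over the same presentation with
the same boundary labels. -/
def IsMinimal : Prop :=
  ∀ Δ' : AnnularDiagram R, Δ.SameBoundaryLabels Δ' → Δ.area ≤ Δ'.area

/-- The diagram tessellates an actual annulus, and it has the smallest area among all such diagrams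
over the same presentation with the same boundary labels. -/
def IsMinimalProper : Prop :=
  Δ.IsProper ∧
    ∀ Δ' : AnnularDiagram R, Δ'.IsProper → Δ.SameBoundaryLabels Δ' → Δ.area ≤ Δ'.area

/-- The path `x` connects the inner boundary component with the outer one. -/
def Connects (x : List Δ.Dart) : Prop :=
  ∃ v w, Δ.OnContour v Δ.inner ∧ Δ.OnContour w Δ.outer ∧ Δ.IsPath v w x

/-- `x` is a shortest path connecting the two boundary components. -/
def IsShortestConnecting (x : List Δ.Dart) : Prop :=
  Δ.Connects x ∧ ∀ y, Δ.Connects y → x.length ≤ y.length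

end AnnularDiagram

/-! The diagram is cut along level curves. For each `i < |x|` let `innerSide i` be the part of the
graph reachable from the inner hole through vertices at distance more than `i` from the outer
boundary component. This part and its complement are both connected, so the edges joining them, a
bond, are crossed by a single closed curve separating the holes. Following the curve, one writes one
letter per crossed edge: the contour label of a cell at that edge, read from it, the position where
the curve leaves this cell, and the residue of `i` modulo a number exceeding all relator lengths.
The alphabet is finite and depends only on the presentation.

If two curves carry the same word, equal residues put them so far apart that no cell reaches from
inside the inner one to outside the outer one. The part between them is cut out and the two bonds
are glued. Equal letters mean that the halves of crossed cells fit together to cells with the old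
labels. The new diagram has the same boundary labels, fewer cells, and is proper if the old one was,
against minimality (`Splice.not_minimal`). Hence the `|x|` words are distinct, and by a Kraft
inequality their total length is at least of order `|x| log |x|` (`mul_log_le_sum_length`). The
bonds are disjoint and a cell has boundedly many darts, so this length is at most a constant times
the area (`sum_card_bond_le`).

Planarity is used in homological form: for a connected graph Euler's formula says that a function on
edges with zero sum around every face is a coboundary (`euler_iff_acyclic`). This yields that a bond
leaves each face at most once and is cyclically ordered by the faces (`bond_face_injective`,
`turnPerm_sameCycle`), and that the glued graph lies on the sphere again (`glue_acyclic`). -/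

/-! ### Rotation systems and the Euler formula -/

/-- A finite graph with a cyclic order on the darts at each vertex, without any condition on the
genus of the surface that carries it. -/
structure RotationSystem (D : Type*) where
  /-- The same edge with the opposite direction. -/
  rev : Equiv.Perm D
  /-- Counterclockwise rotation about the initial vertex. -/
  rot : Equiv.Perm D
  rev_rev : ∀ d, rev (rev d) = d
  rev_ne : ∀ d, rev d ≠ d

namespace RotationSystem

variable {D : Type*} (G : RotationSystem D)

/-- The dart following `d` on the contour of the face to the left of `d`. -/
def next : Equiv.Perm D := G.rot⁻¹ * G.rev

theorem next_apply (d : D) : G.next d = G.rot⁻¹ (G.rev d) := rfl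

theorem rot_next (d : D) : G.rot (G.next d) = G.rev d := by simp [next_apply]

/-- The set of darts `S` consists of all darts leaving some set of vertices. -/
def Invariant (S : Set D) : Prop := ∀ d, G.rot d ∈ S ↔ d ∈ S

/-- The subgraph spanned by the vertices with darts in `S` is connected. -/
def Conn (S : Set D) : Prop :=
  ∀ T : Set D, G.Invariant T → (∀ d ∈ S, G.rev d ∈ S → d ∈ T → G.rev d ∈ T) → S ⊆ T ∨ S ⊆ Tᶜ

/-- Every antisymmetric function on darts whose sum around each face vanishes is the
coboundary of a function on vertices. -/
def Acyclic [Fintype D] : Prop :=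
  ∀ f : D → ℝ, (∀ d, f (G.rev d) = -f d) →
    (∀ h : D → ℝ, (∀ d, h (G.next d) = h d) → ∑ d, f d * h d = 0) →
    ∃ g : D → ℝ, (∀ d, g (G.rot d) = g d) ∧ ∀ d, f d = g (G.rev d) - g d

/-- Every antisymmetric function on darts whose sum around each vertex vanishes is the
coboundary of a function on faces. -/
def DualAcyclic [Fintype D] : Prop :=
  ∀ f : D → ℝ, (∀ d, f (G.rev d) = -f d) →
    (∀ h : D → ℝ, (∀ d, h (G.rot d) = h d) → ∑ d, f d * h d = 0) →
    ∃ g : D → ℝ, (∀ d, g (G.next d) = g d) ∧ ∀ d, f d = g (G.rev d) - g d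

variable {G}

theorem Invariant.compl {S : Set D} (h : G.Invariant S) : G.Invariant Sᶜ := fun d => by
  simp [h d]

/-- The darts `next d` and `rev d` have the same initial vertex. -/
theorem Invariant.next_iff {S : Set D} (h : G.Invariant S) (d : D) :
    G.next d ∈ S ↔ G.rev d ∈ S := by
  rw [← h (G.next d), rot_next]

/-- On a connected set of vertices, a function preserved by the edges is constant. -/
theorem Conn.eq_of {S : Set D} (hS : G.Conn S) {α : Type*} (g : D → α)
    (hrot : ∀ d, g (G.rot d) = g d) (hrev : ∀ d ∈ S, G.rev d ∈ S → g (G.rev d) = g d)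
    {a b : D} (ha : a ∈ S) (hb : b ∈ S) : g a = g b := by
  rcases hS {d | g d = g b} (fun d => by simp [hrot]) (fun d h1 h2 h3 => by
    simpa [hrev d h1 h2] using h3) with h | h
  · exact h ha
  · exact absurd rfl (h hb)

section Euler

open Module

variable (G)

/-- The coboundary, as functions on darts, of functions on `Q`. -/
noncomputable def grad {Q : Type*} (q : D → Q) : (Q → ℝ) →ₗ[ℝ] EuclideanSpace ℝ D where
  toFun g := WithLp.toLp 2 fun d => g (q (G.rev d)) - g (q d)
  map_add' g h := by ext d; simp; ring
  map_smul' c g := by ext d; simp; ring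

/-- The antisymmetric functions on darts. -/
def antisymm : Submodule ℝ (EuclideanSpace ℝ D) where
  carrier := {f | ∀ d, f (G.rev d) = -f d}
  add_mem' {f g} hf hg d := by simp [hf d, hg d]; ring
  zero_mem' d := by simp
  smul_mem' c f hf d := by simp [hf d]

theorem mem_antisymm {f : EuclideanSpace ℝ D} : f ∈ G.antisymm ↔ ∀ d, f (G.rev d) = -f d :=
  Iff.rfl

theorem sameCycle_rev {a b : D} : G.rev.SameCycle a b ↔ b = a ∨ b = G.rev a := by
  constructor
  · rintro ⟨n, rfl⟩
    have h2 : G.rev ^ (2 : ℤ) = 1 := by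
      ext d
      simp [zpow_ofNat, sq, G.rev_rev]
    rcases Int.even_or_odd' n with ⟨k, rfl | rfl⟩
    · left; simp [zpow_mul, h2]
    · right; simp [zpow_add, zpow_mul, h2]
  · rintro (rfl | rfl)
    · exact Equiv.Perm.SameCycle.refl _ _
    · exact ⟨1, rfl⟩

/-- One dart is chosen on each edge; the values there are free because `rev` has no fixed point. -/
theorem finrank_antisymm [Fintype D] :
    finrank ℝ G.antisymm = Nat.card (Quotient (Equiv.Perm.SameCycle.setoid G.rev)) := by
  classical
  set Q := Quotient (Equiv.Perm.SameCycle.setoid G.rev)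
  have hout : ∀ d : D, d = (Quotient.mk _ d : Q).out ∨ d = G.rev (Quotient.mk _ d : Q).out := by
    intro d
    exact G.sameCycle_rev.1 (Quotient.mk_out (s := Equiv.Perm.SameCycle.setoid G.rev) d)
  have hrevq : ∀ d : D, (Quotient.mk _ (G.rev d) : Q) = Quotient.mk _ d := fun d =>
    Quotient.sound (G.sameCycle_rev.2 (Or.inr (G.rev_rev d).symm))
  let φ : G.antisymm →ₗ[ℝ] (Q → ℝ) :=
    { toFun := fun f c => f.1 c.out
      map_add' := fun f g => by ext c; simp
      map_smul' := fun r f => by ext c; simp }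
  have hφ : Function.Bijective φ := by
    constructor
    · rw [injective_iff_map_eq_zero]
      intro f hf
      ext d
      have h0 : f.1 (Quotient.mk _ d : Q).out = 0 := congrFun hf _
      rcases hout d with h | h
      · rw [h]; simpa using h0
      · rw [h, f.2, h0]; simp
    · intro g
      refine ⟨⟨WithLp.toLp 2 fun d => if d = (Quotient.mk _ d : Q).out then g (Quotient.mk _ d)
        else -g (Quotient.mk _ d), fun d => ?_⟩, ?_⟩
      · simp only [hrevq]
        rcases hout d with h | h
        · rw [if_pos h, if_neg]
          rw [← h]; exact G.rev_ne d
        · have h' : G.rev d = (Quotient.mk _ d : Q).out := by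
            conv_lhs => rw [h, G.rev_rev]
          rw [if_pos h', if_neg, neg_neg]
          rw [← h']; exact (G.rev_ne d).symm
      · ext c
        simp [φ]
  rw [(LinearEquiv.ofBijective φ hφ).finrank_eq, Module.finrank_fintype_fun_eq_card,
    Nat.card_eq_fintype_card]

/-- The kernel consists of the constants; this is where connectedness enters the Euler count. -/
theorem finrank_range_grad [Nonempty D] {Q : Type*} [Fintype Q] (q : D → Q)
    (hc : ∀ g : Q → ℝ, (∀ d, g (q (G.rev d)) = g (q d)) → ∀ a b, g a = g b) :
    finrank ℝ (LinearMap.range (G.grad q)) + 1 = Fintype.card Q := by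
  have h1 := LinearMap.finrank_range_add_finrank_ker (G.grad q)
  rw [Module.finrank_fintype_fun_eq_card] at h1
  have hker : finrank ℝ (LinearMap.ker (G.grad q)) = 1 := by
    obtain ⟨d0⟩ := ‹Nonempty D›
    refine finrank_eq_one_iff'.2 ⟨⟨fun _ => 1, ?_⟩, ?_, ?_⟩
    · ext d; simp [grad]
    · intro h
      have := congrFun (congrArg Subtype.val h) (q d0)
      simp at this
    · rintro ⟨g, hg⟩
      refine ⟨g (q d0), ?_⟩
      ext c
      have : ∀ d, g (q (G.rev d)) = g (q d) := fun d => by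
        have := congrArg (fun f : EuclideanSpace ℝ D => f d) hg
        simpa [grad, sub_eq_zero] using this
      simpa using hc g this (q d0) c
  omega

theorem grad_mem_antisymm {Q : Type*} (q : D → Q) (g : Q → ℝ) : G.grad q g ∈ G.antisymm :=
  fun d => by simp [grad, G.rev_rev]

/-- The Euler formula says that the coboundaries of the functions on vertices are the orthogonal
complement of those of the functions on faces. -/
theorem card_add_card_eq_iff [Fintype D] [Nonempty D] {V F : Type*} [Fintype V] [Fintype F] (v : D → V)
    (w : D → F)
    (hvc : ∀ g : V → ℝ, (∀ d, g (v (G.rev d)) = g (v d)) → ∀ a b, g a = g b)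
    (hwc : ∀ g : F → ℝ, (∀ d, g (w (G.rev d)) = g (w d)) → ∀ a b, g a = g b)
    (horth : ∀ (g : V → ℝ) (h : F → ℝ),
      ∑ d, (g (v (G.rev d)) - g (v d)) * (h (w (G.rev d)) - h (w d)) = 0) :
    Fintype.card V + Fintype.card F =
        Nat.card (Quotient (Equiv.Perm.SameCycle.setoid G.rev)) + 2 ↔
      ∀ f : D → ℝ, (∀ d, f (G.rev d) = -f d) →
        (∀ h : F → ℝ, ∑ d, f d * h (w d) = 0) → ∃ g : V → ℝ, ∀ d, f d = g (v (G.rev d)) - g (v d) := by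
  have h1 := G.finrank_range_grad v hvc
  have h2 := G.finrank_range_grad w hwc
  have h3 := G.finrank_antisymm
  have hle2 : LinearMap.range (G.grad w) ≤ G.antisymm := by
    rintro _ ⟨g, rfl⟩; exact G.grad_mem_antisymm w g
  -- The two spaces of coboundaries have dimensions `V - 1` and `F - 1` inside the `E`-dimensional
  -- space of antisymmetric functions, so Euler's formula says that these dimensions are
  -- complementary.
  have h4 := Submodule.finrank_add_inf_finrank_orthogonal hle2
  have hpair : ∀ (f : EuclideanSpace ℝ D), f ∈ G.antisymm → ∀ h : F → ℝ,
      inner ℝ (G.grad w h) f = -2 * ∑ d, f d * h (w d) := by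
    intro f hf h
    have e1 : ∑ d, f d * h (w (G.rev d)) = - ∑ d, f d * h (w d) := by
      rw [← Equiv.sum_comp G.rev (fun d => f d * h (w (G.rev d)))]
      simp [G.rev_rev, hf _]
    simp only [PiLp.inner_apply, grad, LinearMap.coe_mk, AddHom.coe_mk, RCLike.inner_apply,
      conj_trivial, mul_sub, Finset.sum_sub_distrib, e1]
    ring
  have hmem : ∀ f : EuclideanSpace ℝ D, f ∈ (LinearMap.range (G.grad w))ᗮ ⊓ G.antisymm ↔
      (∀ d, f (G.rev d) = -f d) ∧ ∀ h : F → ℝ, ∑ d, f d * h (w d) = 0 := by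
    intro f
    rw [Submodule.mem_inf, and_comm, mem_antisymm]
    refine and_congr_right fun hf => ?_
    rw [Submodule.mem_orthogonal]
    constructor
    · intro H h
      have := H _ ⟨h, rfl⟩
      rw [hpair f hf] at this
      linarith
    · rintro H _ ⟨h, rfl⟩
      rw [hpair f hf, H h]; simp
  have hle : LinearMap.range (G.grad v) ≤ (LinearMap.range (G.grad w))ᗮ ⊓ G.antisymm := by
    rintro _ ⟨g, rfl⟩
    refine ⟨(Submodule.mem_orthogonal _ _).2 ?_, G.grad_mem_antisymm v g⟩
    rintro _ ⟨h, rfl⟩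
    simpa [PiLp.inner_apply, grad] using horth g h
  constructor
  · intro he f hf hfh
    have heq := Submodule.eq_of_le_of_finrank_eq hle (by omega)
    have : WithLp.toLp 2 f ∈ LinearMap.range (G.grad v) := by
      rw [heq, hmem]; exact ⟨hf, hfh⟩
    obtain ⟨g, hg⟩ := this
    exact ⟨g, fun d => (congrArg (fun k : EuclideanSpace ℝ D => k d) hg).symm⟩
  · intro H
    have heq : LinearMap.range (G.grad v) = (LinearMap.range (G.grad w))ᗮ ⊓ G.antisymm := by
      refine le_antisymm hle fun f hf => ?_
      obtain ⟨hf1, hf2⟩ := (hmem f).1 hf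
      obtain ⟨g, hg⟩ := H f hf1 hf2
      exact ⟨g, by ext d; simp [grad, hg d]⟩
    rw [← heq] at h4
    omega

theorem eq_of_sameCycle [Finite D] {π : Equiv.Perm D} {α : Type*} {h : D → α} (hh : ∀ d, h (π d) = h d)
    {a b : D} (hab : π.SameCycle a b) : h a = h b := by
  obtain ⟨n, -, rfl⟩ := hab.exists_pow_eq'
  clear hab
  induction n with
  | zero => rfl
  | succ n ih => rw [pow_succ', Equiv.Perm.mul_apply, hh, ← ih]

theorem mk_perm (π : Equiv.Perm D) (d : D) :
    (Quotient.mk (Equiv.Perm.SameCycle.setoid π) (π d)) = Quotient.mk _ d :=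
  Quotient.sound (Equiv.Perm.sameCycle_apply_left.2 (Equiv.Perm.SameCycle.refl _ _))

theorem euler_iff_aux [Fintype D] [Nonempty D] (hc : G.Conn Set.univ) :
    (Nat.card (Quotient (Equiv.Perm.SameCycle.setoid G.rot)) +
        Nat.card (Quotient (Equiv.Perm.SameCycle.setoid G.next)) =
      Nat.card (Quotient (Equiv.Perm.SameCycle.setoid G.rev)) + 2 ↔ G.Acyclic) ∧
    (Nat.card (Quotient (Equiv.Perm.SameCycle.setoid G.rot)) +
        Nat.card (Quotient (Equiv.Perm.SameCycle.setoid G.next)) =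
      Nat.card (Quotient (Equiv.Perm.SameCycle.setoid G.rev)) + 2 ↔ G.DualAcyclic) := by
  classical
  set v : D → Quotient (Equiv.Perm.SameCycle.setoid G.rot) := Quotient.mk _
  set w : D → Quotient (Equiv.Perm.SameCycle.setoid G.next) := Quotient.mk _
  have hvrot : ∀ d, v (G.rot d) = v d := mk_perm G.rot
  have hwnext : ∀ d, w (G.next d) = w d := mk_perm G.next
  have hvnext : ∀ d, v (G.rev d) = v (G.next d) := fun d => by rw [← hvrot (G.next d), rot_next]
  have hvc : ∀ g : Quotient (Equiv.Perm.SameCycle.setoid G.rot) → ℝ,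
      (∀ d, g (v (G.rev d)) = g (v d)) → ∀ a b, g a = g b := by
    intro g hg a b
    induction a using Quotient.inductionOn with | _ a
    induction b using Quotient.inductionOn with | _ b
    exact hc.eq_of (fun d => g (v d)) (fun d => by simp [hvrot]) (fun d _ _ => hg d)
      (Set.mem_univ a) (Set.mem_univ b)
  have hwc : ∀ g : Quotient (Equiv.Perm.SameCycle.setoid G.next) → ℝ,
      (∀ d, g (w (G.rev d)) = g (w d)) → ∀ a b, g a = g b := by
    intro g hg a b
    induction a using Quotient.inductionOn with | _ a
    induction b using Quotient.inductionOn with | _ b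
    refine hc.eq_of (fun d => g (w d)) (fun d => ?_) (fun d _ _ => hg d)
      (Set.mem_univ a) (Set.mem_univ b)
    have h1 : G.next (G.rev (G.rot d)) = d := by simp [next_apply, G.rev_rev]
    change g (w (G.rot d)) = g (w d)
    rw [← hg (G.rot d), ← hwnext (G.rev (G.rot d)), h1]
  -- The coboundary of a vertex function telescopes around every face.
  have horth : ∀ (g : Quotient (Equiv.Perm.SameCycle.setoid G.rot) → ℝ)
      (h : Quotient (Equiv.Perm.SameCycle.setoid G.next) → ℝ),
      ∑ d, (g (v (G.rev d)) - g (v d)) * (h (w (G.rev d)) - h (w d)) = 0 := by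
    intro g h
    have e1 : ∑ d, g (v (G.rev d)) * h (w (G.rev d)) = ∑ d, g (v d) * h (w d) :=
      Equiv.sum_comp G.rev (fun d => g (v d) * h (w d))
    have e2 : ∑ d, g (v d) * h (w (G.rev d)) = ∑ d, g (v (G.rev d)) * h (w d) := by
      rw [← Equiv.sum_comp G.rev (fun d => g (v d) * h (w (G.rev d)))]
      simp [G.rev_rev]
    have e3 : ∑ d, g (v (G.rev d)) * h (w d) = ∑ d, g (v d) * h (w d) := by
      rw [← Equiv.sum_comp G.next (fun d => g (v d) * h (w d))]
      simp [hwnext, hvnext]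
    simp only [sub_mul, mul_sub, Finset.sum_sub_distrib, e1, e2, e3]
    ring
  have k1 := G.card_add_card_eq_iff v w hvc hwc horth
  have k2 := G.card_add_card_eq_iff w v hwc hvc
    (fun g h => by simpa only [mul_comm] using horth h g)
  have lift1 : ∀ h : D → ℝ, (∀ d, h (G.rot d) = h d) → ∃ h' : _ → ℝ, ∀ d, h d = h' (v d) := fun h hh =>
    ⟨Quotient.lift h fun a b hab => eq_of_sameCycle hh hab, fun d => rfl⟩
  have lift2 : ∀ h : D → ℝ, (∀ d, h (G.next d) = h d) → ∃ h' : _ → ℝ, ∀ d, h d = h' (w d) := fun h hh =>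
    ⟨Quotient.lift h fun a b hab => eq_of_sameCycle hh hab, fun d => rfl⟩
  simp only [Nat.card_eq_fintype_card] at k1 k2 ⊢
  rw [add_comm] at k2
  refine ⟨k1.trans ⟨fun H f hf hfh => ?_, fun H f hf hfh => ?_⟩,
    k2.trans ⟨fun H f hf hfh => ?_, fun H f hf hfh => ?_⟩⟩
  · obtain ⟨g, hg⟩ := H f hf fun h => hfh (fun d => h (w d)) fun d => by simp [hwnext]
    exact ⟨fun d => g (v d), fun d => by simp [hvrot], hg⟩
  · obtain ⟨g, hg1, hg2⟩ := H f hf fun h hh => by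
      obtain ⟨h', e⟩ := lift2 h hh
      simpa [e] using hfh h'
    obtain ⟨g', e⟩ := lift1 g hg1
    exact ⟨g', fun d => by rw [hg2, e, e]⟩
  · obtain ⟨g, hg⟩ := H f hf fun h => hfh (fun d => h (v d)) fun d => by simp [hvrot]
    exact ⟨fun d => g (w d), fun d => by simp [hwnext], hg⟩
  · obtain ⟨g, hg1, hg2⟩ := H f hf fun h hh => by
      obtain ⟨h', e⟩ := lift1 h hh
      simpa [e] using hfh h'
    obtain ⟨g', e⟩ := lift2 g hg1
    exact ⟨g', fun d => by rw [hg2, e, e]⟩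

/-- For a connected graph, the Euler formula is equivalent to acyclicity. -/
theorem euler_iff_acyclic [Fintype D] [Nonempty D] (hc : G.Conn Set.univ) :
    Nat.card (Quotient (Equiv.Perm.SameCycle.setoid G.rot)) +
        Nat.card (Quotient (Equiv.Perm.SameCycle.setoid G.next)) =
      Nat.card (Quotient (Equiv.Perm.SameCycle.setoid G.rev)) + 2 ↔ G.Acyclic :=
  (G.euler_iff_aux hc).1

theorem Acyclic.dual [Fintype D] [Nonempty D] {G : RotationSystem D} (h : G.Acyclic)
    (hc : G.Conn Set.univ) : G.DualAcyclic :=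
  (G.euler_iff_aux hc).2.1 ((G.euler_iff_aux hc).1.2 h)

end Euler

end RotationSystem

/-! ### Bonds of plane graphs -/

namespace RotationSystem

variable {D : Type*} (G : RotationSystem D)

/-- The darts leaving the set of vertices `S`. -/
def bond (S : Set D) : Set D := {d | d ∈ S ∧ G.rev d ∉ S}

/-- The number of darts outside `S` that follow `d` on its face contour before it returns to `S`. -/
noncomputable def run (S : Set D) (d : D) : ℕ := sInf {t | G.next^[t + 1] d ∈ S}

/-- The dart leaving `S` by which the face contour leaving `S` along `d` returns, reversed. -/
noncomputable def turn (S : Set D) (d : D) : D := G.rev (G.next^[G.run S d] d)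

variable {G}

theorem sameCycle_iterate (π : Equiv.Perm D) (n : ℕ) (d : D) : π.SameCycle d (π^[n] d) :=
  ⟨n, by simp [Equiv.Perm.iterate_eq_pow]⟩

theorem _root_.Equiv.Perm.SameCycle.exists_iterate_eq [Finite D] {π : Equiv.Perm D} {a b : D}
    (h : π.SameCycle a b) : ∃ n, π^[n] a = b := by
  obtain ⟨n, -, e⟩ := h.exists_pow_eq'
  exact ⟨n, by rw [Equiv.Perm.iterate_eq_pow, e]⟩

theorem mem_periodicPts [Finite D] (π : Equiv.Perm D) (d : D) : d ∈ Function.periodicPts π :=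
  π.injective.mem_periodicPts d

theorem exists_iterate_lt_of_sameCycle [Finite D] {a d : D} (h : G.next.SameCycle a d) :
    ∃ k, k < Function.minimalPeriod G.next a ∧ G.next^[k] a = d := by
  obtain ⟨n, rfl⟩ := h.exists_iterate_eq
  exact ⟨n % Function.minimalPeriod G.next a,
    Nat.mod_lt _ (Function.minimalPeriod_pos_of_mem_periodicPts (mem_periodicPts _ _)),
    Function.iterate_mod_minimalPeriod_eq⟩

/-- A face contour is closed, so it leaves `S` as often as it enters `S`. -/
theorem sum_bond [Fintype D] {S : Set D} (hS : G.Invariant S) {h : D → ℝ}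
    (hh : ∀ d, h (G.next d) = h d) [DecidablePred (· ∈ G.bond S)] :
    ∑ d with d ∈ G.bond S, h d = ∑ d with d ∈ G.bond S, h (G.rev d) := by
  classical
  have e1 : ∑ d, (if d ∈ S then h d else 0) = ∑ d, (if G.rev d ∈ S then h d else 0) := by
    rw [← Equiv.sum_comp G.next]
    simp [hh, hS.next_iff]
  have e2 : ∑ d with d ∈ G.bond S, h (G.rev d) = ∑ d with G.rev d ∈ G.bond S, h d := by
    simp only [Finset.sum_filter]
    rw [← Equiv.sum_comp G.rev]
    simp [G.rev_rev]
  rw [e2, Finset.sum_filter, Finset.sum_filter, ← sub_eq_zero, ← Finset.sum_sub_distrib]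
  rw [← sub_eq_zero, ← Finset.sum_sub_distrib] at e1
  refine Eq.trans (Finset.sum_congr rfl fun d _ => ?_) e1
  simp only [bond, Set.mem_ofPred_eq, G.rev_rev]
  by_cases h1 : d ∈ S <;> by_cases h2 : G.rev d ∈ S <;> simp [h1, h2]

/-- A set of edges of a bond that meets each face evenly is empty or the whole bond. -/
theorem bond_subset_of_balanced [Fintype D] (hA : G.Acyclic) {S : Set D} (hS : G.Conn S)
    (hS' : G.Conn Sᶜ) {U : Finset D} (hU : ↑U ⊆ G.bond S) (hne : U.Nonempty)
    (hbal : ∀ h : D → ℝ, (∀ d, h (G.next d) = h d) → ∑ d ∈ U, h d = ∑ d ∈ U, h (G.rev d)) :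
    G.bond S ⊆ U := by
  classical
  -- The signed indicator of `U` has zero sum around each face, hence is the coboundary of some `g`.
  -- It vanishes off the bond, so `g` is constant on either side, and the jump of `g`, which is 1 on
  -- `U`, is the same along the whole bond.
  obtain ⟨g, hg1, hg2⟩ := hA
    (fun d => (if d ∈ U then 1 else 0) - (if G.rev d ∈ U then 1 else 0))
    (fun d => by simp [G.rev_rev]) (fun h hh => by
      have e : ∑ d, (if G.rev d ∈ U then h d else 0) = ∑ d ∈ U, h (G.rev d) := by
        rw [← Equiv.sum_comp G.rev]
        simp [G.rev_rev]
      simp [sub_mul, e, hbal h hh])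
  have hin : ∀ d, (d ∈ S ↔ G.rev d ∈ S) → g (G.rev d) = g d := by
    intro d hd
    have h1 : d ∉ U := fun h => (hU h).2 (hd.1 (hU h).1)
    have h2 : G.rev d ∉ U := fun h => (hU h).2 (by rw [G.rev_rev]; exact hd.2 (hU h).1)
    have := hg2 d
    simp only [h1, h2, if_false] at this
    linarith
  intro b hb
  obtain ⟨a, ha⟩ := hne
  have ha' := hU ha
  have e1 : g a = g b := hS.eq_of g hg1 (fun d h1 h2 => hin d (iff_of_true h1 h2)) ha'.1 hb.1
  have e2 : g (G.rev a) = g (G.rev b) :=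
    hS'.eq_of g hg1 (fun d h1 h2 => hin d (iff_of_false h1 h2)) ha'.2 hb.2
  have e3 := hg2 a
  have e4 := hg2 b
  have h1 : G.rev a ∉ U := fun h => ha'.2 (hU h).1
  have h2 : G.rev b ∉ U := fun h => hb.2 (hU h).1
  simp only [ha, h1, h2, if_true, if_false] at e3 e4
  by_contra hbU
  simp only [Finset.mem_coe] at hbU
  simp only [hbU, if_false] at e4
  linarith

/-- A permutation of a bond that follows faces is transitive. -/
theorem bond_perm_sameCycle [Fintype D] (hA : G.Acyclic) {S : Set D} (hS : G.Conn S)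
    (hS' : G.Conn Sᶜ) (σ : Equiv.Perm (G.bond S))
    (hσ : ∀ d : G.bond S, G.next.SameCycle d.1 (G.rev (σ d))) (a b : G.bond S) : σ.SameCycle a b := by
  classical
  -- An orbit of `σ` is balanced, since `σ` pairs each exit from `S` with an entry along the same
  -- face.
  let U : Finset D := ({x | σ.SameCycle a x} : Finset (G.bond S)).map (Function.Embedding.subtype _)
  have := bond_subset_of_balanced hA hS hS' (U := U) (by
      intro d hd
      simp only [U, Finset.coe_map, Set.mem_image] at hd
      obtain ⟨x, -, rfl⟩ := hd
      exact x.2)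
    ⟨a, by simp only [U, Finset.mem_map]; exact ⟨a, by simp [Equiv.Perm.SameCycle.refl], rfl⟩⟩
    (fun h hh => by
      simp only [U, Finset.sum_map, Function.Embedding.subtype_apply]
      refine Finset.sum_equiv σ (fun x => by simp) fun x _ => ?_
      exact eq_of_sameCycle hh (hσ x))
  have hb := this b.2
  simp only [U, Finset.coe_map, Set.mem_image] at hb
  obtain ⟨x, hx, e⟩ := hb
  have : x = b := Subtype.ext e
  subst this
  simpa using hx

/-- A bond of a plane graph leaves each face at most once. -/
theorem bond_face_injective [Fintype D] (hA : G.Acyclic) {S : Set D} (hSi : G.Invariant S)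
    (hS : G.Conn S) (hS' : G.Conn Sᶜ) {a b : D} (ha : a ∈ G.bond S) (hb : b ∈ G.bond S)
    (hab : G.next.SameCycle a b) : a = b := by
  classical
  by_contra hne
  let w : D → Quotient (Equiv.Perm.SameCycle.setoid G.next) := Quotient.mk _
  -- Equal numbers of exits and entries on each face allow a permutation `σ` that follows faces.
  have hcard : ∀ q, Nonempty ({x : G.bond S // w x = q} ≃ {x : G.bond S // w (G.rev x) = q}) := by
    intro q
    rw [← Fintype.card_eq, ← Nat.cast_inj (R := ℝ)]
    have := sum_bond hSi (h := fun d => if w d = q then 1 else 0)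
      (fun d => by simp only [w, mk_perm])
    have key : ∀ (r : D → Prop) [DecidablePred r], ∑ d with d ∈ G.bond S, (if r d then (1 : ℝ) else 0) =
        (Fintype.card {x : G.bond S // r x} : ℝ) := by
      intro r _
      rw [Fintype.card_subtype, ← Finset.sum_boole]
      exact Finset.sum_subtype _ (fun x => by simp) _
    exact (key fun d => w d = q).symm.trans (this.trans (key fun d => w (G.rev d) = q))
  let σ : Equiv.Perm (G.bond S) :=
    Equiv.ofFiberEquiv (f := fun x : G.bond S => w x) (g := fun x : G.bond S => w (G.rev x))
      fun q => (hcard q).some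
  have hσ : ∀ d : G.bond S, G.next.SameCycle d.1 (G.rev (σ d)) := fun d =>
    Quotient.exact (s := Equiv.Perm.SameCycle.setoid G.next)
      (Equiv.ofFiberEquiv_map (f := fun x : G.bond S => w x)
        (g := fun x : G.bond S => w (G.rev x)) (fun q => (hcard q).some) d).symm
  let a' : G.bond S := ⟨a, ha⟩
  let b' : G.bond S := ⟨b, hb⟩
  have hne' : a' ≠ b' := fun h => hne (congrArg Subtype.val h)
  -- Every permutation following faces is a single cycle on the whole bond, so its sign depends only
  -- on the size of the bond.
  have hcyc : ∀ τ : Equiv.Perm (G.bond S), (∀ d : G.bond S, G.next.SameCycle d.1 (G.rev (τ d))) →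
      Equiv.Perm.sign τ = -(-1) ^ Fintype.card (G.bond S) := by
    intro τ hτ
    have htrans := bond_perm_sameCycle hA hS hS' τ hτ
    have hmove : ∀ x, τ x ≠ x := by
      intro x hx
      obtain ⟨y, hy⟩ : ∃ y, y ≠ x := by
        by_cases h : a' = x
        · exact ⟨b', fun h' => hne' (h.trans h'.symm)⟩
        · exact ⟨a', h⟩
      exact hy ((htrans x y).eq_of_left hx).symm
    have hc : τ.IsCycle := ⟨a', hmove a', fun y _ => htrans a' y⟩
    rw [hc.sign]
    congr 2
    rw [show τ.support = Finset.univ by ext x; simp [hmove x], Finset.card_univ]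
  have s1 := hcyc σ hσ
  -- Two exits on one face may be interchanged without ceasing to follow faces, but this flips the
  -- sign.
  have s2 := hcyc (σ * Equiv.swap a' b') (fun d => by
    rw [Equiv.Perm.mul_apply]
    refine Equiv.Perm.SameCycle.trans ?_ (hσ _)
    rw [Equiv.swap_apply_def]
    split_ifs with h1 h2
    · rw [h1]; exact hab
    · rw [h2]; exact hab.symm
    · exact Equiv.Perm.SameCycle.refl _ _)
  rw [Equiv.Perm.sign_mul, Equiv.Perm.sign_swap hne', s1] at s2
  rcases Int.units_eq_one_or ((-1) ^ Fintype.card (G.bond S)) with h | h <;> rw [h] at s2 <;>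
    revert s2 <;> decide

/-! ### How face contours cross a bond -/

section Run

variable {S : Set D} {d : D}

theorem iterate_run_add_one_mem [Finite D] (hd : d ∈ G.bond S) : G.next^[G.run S d + 1] d ∈ S := by
  have hp := Function.minimalPeriod_pos_of_mem_periodicPts (mem_periodicPts G.next d)
  refine Nat.sInf_mem (s := {t | G.next^[t + 1] d ∈ S})
    ⟨Function.minimalPeriod G.next d - 1, ?_⟩
  rw [Set.mem_ofPred_eq, Nat.sub_add_cancel hp, Function.iterate_minimalPeriod]
  exact hd.1

theorem iterate_notMem_of_le_run {s : ℕ} (hs : 1 ≤ s) (hsr : s ≤ G.run S d) :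
    G.next^[s] d ∉ S := by
  have := Nat.notMem_of_lt_sInf (s := {t | G.next^[t + 1] d ∈ S}) (m := s - 1)
    (by have : G.run S d = sInf {t | G.next^[t + 1] d ∈ S} := rfl
        omega)
  rwa [Set.mem_ofPred_eq, Nat.sub_add_cancel hs] at this

theorem run_pos [Finite D] (hS : G.Invariant S) (hd : d ∈ G.bond S) : 1 ≤ G.run S d := by
  by_contra h
  have h0 : G.run S d = 0 := by omega
  have := iterate_run_add_one_mem hd
  rw [h0] at this
  exact hd.2 ((hS.next_iff d).1 this)

theorem run_lt [Finite D] (hd : d ∈ G.bond S) : G.run S d < Function.minimalPeriod G.next d := by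
  have hp := Function.minimalPeriod_pos_of_mem_periodicPts (mem_periodicPts G.next d)
  by_contra h
  refine iterate_notMem_of_le_run hp (not_lt.1 h) ?_
  rw [Function.iterate_minimalPeriod]
  exact hd.1

theorem turn_mem [Finite D] (hS : G.Invariant S) (hd : d ∈ G.bond S) : G.turn S d ∈ G.bond S := by
  have h1 := iterate_run_add_one_mem hd
  rw [Function.iterate_succ_apply', hS.next_iff] at h1
  refine ⟨h1, ?_⟩
  rw [turn, G.rev_rev]
  exact iterate_notMem_of_le_run (run_pos hS hd) le_rfl

theorem rev_turn (d : D) : G.rev (G.turn S d) = G.next^[G.run S d] d := G.rev_rev _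

theorem sameCycle_turn (d : D) : G.next.SameCycle d (G.rev (G.turn S d)) := by
  rw [rev_turn]; exact sameCycle_iterate _ _ _

/-- Leaving `S` a second time would give another bond dart on the same face. Thus the contour from
`d` is `d`, then `run` darts outside `S`, then darts inside `S` until it closes. -/
theorem iterate_mem_of_run_lt [Fintype D] (hA : G.Acyclic) (hSi : G.Invariant S)
    (hS : G.Conn S) (hS' : G.Conn Sᶜ) (hd : d ∈ G.bond S) {s : ℕ} (hs : G.run S d < s)
    (hsp : s ≤ Function.minimalPeriod G.next d) : G.next^[s] d ∈ S := by
  induction s, hs using Nat.le_induction with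
  | base => exact iterate_run_add_one_mem hd
  | succ s hs ih =>
    have h1 := ih (by omega)
    by_contra h2
    rw [Function.iterate_succ_apply', hSi.next_iff] at h2
    have h3 := bond_face_injective hA hSi hS hS' hd ⟨h1, h2⟩ (sameCycle_iterate _ _ _)
    have := Function.IsPeriodicPt.minimalPeriod_le (n := s) (by omega) h3.symm
    omega

theorem turn_injOn [Fintype D] (hA : G.Acyclic) (hSi : G.Invariant S)
    (hS : G.Conn S) (hS' : G.Conn Sᶜ) : Set.InjOn (G.turn S) (G.bond S) := by
  intro a ha b hb hab
  refine bond_face_injective hA hSi hS hS' ha hb ((sameCycle_turn (S := S) a).trans ?_)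
  rw [hab]
  exact (sameCycle_turn b).symm

variable (G S) in
/-- The cyclic order on a bond given by the faces outside `S`. -/
noncomputable def turnPerm [Fintype D] (hA : G.Acyclic) (hSi : G.Invariant S)
    (hS : G.Conn S) (hS' : G.Conn Sᶜ) : Equiv.Perm (G.bond S) :=
  Equiv.ofBijective (fun d => ⟨G.turn S d, turn_mem hSi d.2⟩) (Finite.injective_iff_bijective.1
    fun a b hab => Subtype.ext (turn_injOn hA hSi hS hS' a.2 b.2 (congrArg Subtype.val hab)))

theorem turnPerm_sameCycle [Fintype D] (hA : G.Acyclic) (hSi : G.Invariant S)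
    (hS : G.Conn S) (hS' : G.Conn Sᶜ) (a b : G.bond S) :
    (G.turnPerm S hA hSi hS hS').SameCycle a b :=
  bond_perm_sameCycle hA hS hS' _ (fun d => sameCycle_turn d.1) a b

end Run

end RotationSystem

/-! ### Potentials on one side of a bond -/

namespace RotationSystem

variable {D : Type*} {G : RotationSystem D}

/-- If the complement of `S` is connected, then a function on the edges inside `S` whose sum around
each face inside `S` vanishes is a coboundary. -/
theorem exists_potential_on [Fintype D] [Nonempty D] (hA : G.Acyclic) (hc : G.Conn Set.univ)
    {S : Set D} (hSi : G.Invariant S) (hS' : G.Conn Sᶜ) (f : D → ℝ)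
    (hf : ∀ d, f (G.rev d) = -f d) (hsupp : ∀ d, ¬(d ∈ S ∧ G.rev d ∈ S) → f d = 0)
    (hcoc : ∀ h : D → ℝ, (∀ d, h (G.next d) = h d) → (∀ d ∉ S, h d = 0) →
      ∑ d, f d * h d = 0) :
    ∃ g : D → ℝ, (∀ d, g (G.rot d) = g d) ∧
      ∀ d ∈ S, G.rev d ∈ S → f d = g (G.rev d) - g d := by
  classical
  set v : D → Quotient (Equiv.Perm.SameCycle.setoid G.rot) := Quotient.mk _
  have hvrot : ∀ d, v (G.rot d) = v d := mk_perm G.rot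
  let A : (Quotient (Equiv.Perm.SameCycle.setoid G.rot) → ℝ) →ₗ[ℝ] EuclideanSpace ℝ D :=
    { toFun := fun g => WithLp.toLp 2 fun d =>
        if d ∈ S ∧ G.rev d ∈ S then g (v (G.rev d)) - g (v d) else 0
      map_add' := fun g h => by
        ext d
        by_cases hd : d ∈ S ∧ G.rev d ∈ S <;> simp [hd]
        ring
      map_smul' := fun c g => by
        ext d
        by_cases hd : d ∈ S ∧ G.rev d ∈ S <;> simp [hd]
        ring }
  have hrevswap : ∀ F : D → ℝ, ∑ d, F (G.rev d) = ∑ d, F d := fun F => Equiv.sum_comp G.rev F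
  suffices h : WithLp.toLp 2 f ∈ LinearMap.range A by
    obtain ⟨g, hg⟩ := h
    refine ⟨fun d => g (v d), fun d => by simp [hvrot], fun d h1 h2 => ?_⟩
    have := congrArg (fun k : EuclideanSpace ℝ D => k d) hg
    simpa [A, h1, h2] using this.symm
  -- Being a coboundary inside `S` is tested against every `y` orthogonal to those coboundaries.
  -- Antisymmetrizing such a `y` on the edges inside `S` gives a circulation `z`, which dual
  -- acyclicity writes as the coboundary of a face function `k`.
  rw [← Submodule.orthogonal_orthogonal (LinearMap.range A), Submodule.mem_orthogonal]
  intro y hy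
  rw [Submodule.mem_orthogonal] at hy
  let z : D → ℝ := fun d => if d ∈ S ∧ G.rev d ∈ S then y d - y (G.rev d) else 0
  have hz : ∀ d, z (G.rev d) = -z d := by
    intro d
    by_cases h : d ∈ S ∧ G.rev d ∈ S
    · simp [z, h, G.rev_rev]
    · have h' : ¬(G.rev d ∈ S ∧ d ∈ S) := fun k => h k.symm
      simp [z, h, h', G.rev_rev]
  obtain ⟨k, hk1, hk2⟩ := hA.dual hc z hz (fun h hh => by
    obtain ⟨h', e⟩ : ∃ h' : _ → ℝ, ∀ d, h d = h' (v d) :=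
      ⟨Quotient.lift h fun a b hab => eq_of_sameCycle hh hab, fun d => rfl⟩
    have h0 := hy _ ⟨h', rfl⟩
    simp only [A, LinearMap.coe_mk, AddHom.coe_mk, PiLp.inner_apply, RCLike.inner_apply,
      conj_trivial] at h0
    have e1 : ∑ d, (if d ∈ S ∧ G.rev d ∈ S then y (G.rev d) * h d else 0) =
        ∑ d, (if d ∈ S ∧ G.rev d ∈ S then y d * h (G.rev d) else 0) := by
      rw [← hrevswap]
      refine Finset.sum_congr rfl fun d _ => ?_
      simp [G.rev_rev, and_comm]
    have e2 : ∑ d, z d * h d = ∑ d, (if d ∈ S ∧ G.rev d ∈ S then y d * h d else 0) -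
        ∑ d, (if d ∈ S ∧ G.rev d ∈ S then y (G.rev d) * h d else 0) := by
      rw [← Finset.sum_sub_distrib]
      refine Finset.sum_congr rfl fun d _ => ?_
      simp only [z]
      split_ifs <;> ring
    rw [e2, e1, ← Finset.sum_sub_distrib, ← neg_eq_zero, ← Finset.sum_neg_distrib]
    refine Eq.trans (Finset.sum_congr rfl fun d _ => ?_) h0
    rw [← e, ← e]
    split_ifs <;> ring)
  have hoff : ∀ d, ¬(d ∈ S ∧ G.rev d ∈ S) → k (G.rev d) = k d := fun d hd => by
    have := hk2 d
    simp only [z, hd, if_false] at this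
    linarith
  -- As `z` vanishes on edges that meet the connected complement of `S`, all faces touching it have
  -- the same `k`. So `k - c` is an admissible test function for `f`.
  obtain ⟨c, hconst⟩ : ∃ c, ∀ d ∉ S, k d = c := by
    by_cases hne : ∃ b, b ∉ S
    · obtain ⟨b, hb⟩ := hne
      refine ⟨k b, fun d hd => ?_⟩
      have := hS'.eq_of (fun d => if d ∈ S then 0 else k d) (fun d => by
          simp only [hSi d]
          split_ifs with h
          · rfl
          · have h1 : G.next (G.rev (G.rot d)) = d := by simp [next_apply, G.rev_rev]
            rw [← hoff (G.rot d) (fun h' => h ((hSi d).1 h'.1)), ← hk1 (G.rev (G.rot d)), h1])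
        (fun d h1 h2 => by
          have h1' : d ∉ S := h1
          have h2' : G.rev d ∉ S := h2
          simp only [h1', h2', if_false]
          exact hoff d fun h => h1' h.1) (a := d) (b := b) hd hb
      simpa [hd, hb] using this
    · exact ⟨0, fun d hd => absurd ⟨d, hd⟩ hne⟩
  have h1 := hcoc (fun d => k d - c) (fun d => by rw [hk1]) (fun d hd => by rw [hconst d hd, sub_self])
  have hsum : ∑ d, f d = 0 := by
    have := hrevswap f
    simp only [hf, Finset.sum_neg_distrib] at this
    linarith
  have hfk : ∑ d, f d * k d = 0 := by
    simpa [mul_sub, Finset.sum_sub_distrib, ← Finset.sum_mul, hsum] using h1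
  have hfkr : ∑ d, f d * k (G.rev d) = 0 := by
    rw [← hrevswap]
    simp [hf, G.rev_rev, hfk]
  have hfy : ∑ d, f d * z d = 2 * ∑ d, f d * y d := by
    have e1 : ∑ d, f d * y (G.rev d) = - ∑ d, f d * y d := by
      rw [← hrevswap]
      simp [hf, G.rev_rev]
    rw [two_mul, ← sub_neg_eq_add, ← e1, ← Finset.sum_sub_distrib]
    refine Finset.sum_congr rfl fun d _ => ?_
    by_cases h : d ∈ S ∧ G.rev d ∈ S
    · simp [z, h, mul_sub]
    · simp [hsupp d h]
  have hfz : ∑ d, f d * z d = 0 := by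
    simp only [hk2, mul_sub, Finset.sum_sub_distrib, hfk, hfkr, sub_self]
  simp only [PiLp.inner_apply, RCLike.inner_apply, conj_trivial]
  linarith

end RotationSystem

/-! ### Cutting out the part of a plane graph between two bonds -/

namespace RotationSystem

variable {D : Type*} {G : RotationSystem D}

theorem sum_grad_mul_eq_zero [Fintype D] {g h : D → ℝ} (hg : ∀ d, g (G.rot d) = g d)
    (hh : ∀ d, h (G.next d) = h d) : ∑ d, (g (G.rev d) - g d) * h d = 0 := by
  have e3 : ∑ d, g (G.rev d) * h d = ∑ d, g d * h d := by
    rw [← Equiv.sum_comp G.next (fun d => g d * h d)]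
    refine Finset.sum_congr rfl fun d _ => ?_
    rw [hh, ← hg (G.next d), rot_next]
  simp [sub_mul, e3]

variable (G) in
/-- Two nested bonds of a plane graph that are crossed by faces in the same pattern. -/
structure Splice [Fintype D] (S₁ S₂ : Set D) where
  acyclic : G.Acyclic
  conn : G.Conn Set.univ
  inv₁ : G.Invariant S₁
  inv₂ : G.Invariant S₂
  conn₁ : G.Conn S₁
  conn₁_compl : G.Conn S₁ᶜ
  conn₂ : G.Conn S₂
  conn₂_compl : G.Conn S₂ᶜ
  subset : S₁ ⊆ S₂
  nonempty : (G.bond S₁).Nonempty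
  /-- The correspondence between the two bonds. -/
  e : G.bond S₁ ≃ G.bond S₂
  turn_e : ∀ b c : G.bond S₁, c.1 = G.turn S₁ b → (e c).1 = G.turn S₂ (e b)
  run_e : ∀ b, G.run S₂ (e b) = G.run S₁ b
  period_e : ∀ b : G.bond S₁, Function.minimalPeriod G.next (e b).1 =
    Function.minimalPeriod G.next b.1

/-! ### The glued graph: faces, connectedness, acyclicity -/

namespace Splice

variable [Fintype D] {S₁ S₂ : Set D} (s : G.Splice S₁ S₂)

/-- The darts that remain when the part between the two bonds is cut out. -/
abbrev Dart (_ : G.Splice S₁ S₂) : Type _ := {d : D // d ∈ S₁ ∨ d ∉ S₂}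

/-- A dart of the inner bond, as a dart of the spliced graph. -/
def ofBond (b : G.bond S₁) : s.Dart := ⟨b.1, Or.inl b.2.1⟩

/-- A dart of the outer bond, reversed, as a dart of the spliced graph. -/
def ofRevBond (c : G.bond S₂) : s.Dart := ⟨G.rev c.1, Or.inr c.2.2⟩

open Classical in
/-- The edges of the inner bond are glued to the corresponding edges of the outer bond. -/
noncomputable def revFun (x : s.Dart) : s.Dart :=
  if h : x.1 ∈ G.bond S₁ then s.ofRevBond (s.e ⟨x.1, h⟩)
  else if h' : G.rev x.1 ∈ G.bond S₂ then s.ofBond (s.e.symm ⟨G.rev x.1, h'⟩)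
  else ⟨G.rev x.1, by
    by_cases h1 : x.1 ∈ S₁
    · exact Or.inl (not_not.1 fun h2 => h ⟨h1, h2⟩)
    · exact Or.inr fun h2 => h' ⟨h2, by rw [G.rev_rev]; exact x.2.resolve_left h1⟩⟩

theorem revFun_ofBond (b : G.bond S₁) : s.revFun (s.ofBond b) = s.ofRevBond (s.e b) :=
  dif_pos b.2

theorem revFun_ofRevBond (c : G.bond S₂) : s.revFun (s.ofRevBond c) = s.ofBond (s.e.symm c) := by
  have h1 : ¬ (s.ofRevBond c).1 ∈ G.bond S₁ := fun h => c.2.2 (s.subset h.1)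
  have h2 : G.rev (s.ofRevBond c).1 = c.1 := G.rev_rev _
  have h3 : G.rev (s.ofRevBond c).1 ∈ G.bond S₂ := h2 ▸ c.2
  rw [revFun, dif_neg h1, dif_pos h3]
  congr 2
  exact Subtype.ext h2

theorem revFun_val {x : s.Dart} (h : x.1 ∉ G.bond S₁) (h' : G.rev x.1 ∉ G.bond S₂) :
    (s.revFun x).1 = G.rev x.1 := by
  rw [revFun, dif_neg h, dif_neg h']

theorem cases (x : s.Dart) : (∃ b, x = s.ofBond b) ∨ (∃ c, x = s.ofRevBond c) ∨
    (x.1 ∉ G.bond S₁ ∧ G.rev x.1 ∉ G.bond S₂) := by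
  by_cases h : x.1 ∈ G.bond S₁
  · exact Or.inl ⟨⟨x.1, h⟩, rfl⟩
  · by_cases h' : G.rev x.1 ∈ G.bond S₂
    · exact Or.inr (Or.inl ⟨⟨G.rev x.1, h'⟩, Subtype.ext (G.rev_rev _).symm⟩)
    · exact Or.inr (Or.inr ⟨h, h'⟩)

theorem revFun_mem_iff {x : s.Dart} (h : x.1 ∉ G.bond S₁) (h' : G.rev x.1 ∉ G.bond S₂) :
    G.rev x.1 ∈ S₁ ↔ x.1 ∈ S₁ := by
  constructor
  · intro h1
    by_contra h2
    exact h' ⟨s.subset h1, by rw [G.rev_rev]; exact x.2.resolve_left h2⟩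
  · intro h1
    by_contra h2
    exact h ⟨h1, h2⟩

theorem revFun_revFun (x : s.Dart) : s.revFun (s.revFun x) = x := by
  rcases s.cases x with ⟨b, rfl⟩ | ⟨c, rfl⟩ | ⟨h1, h2⟩
  · rw [revFun_ofBond, revFun_ofRevBond, Equiv.symm_apply_apply]
  · rw [revFun_ofRevBond, revFun_ofBond, Equiv.apply_symm_apply]
  · have e := s.revFun_val h1 h2
    have hm := s.revFun_mem_iff h1 h2
    refine Subtype.ext ?_
    rw [s.revFun_val, e, G.rev_rev]
    · rw [e]
      rintro ⟨h3, h4⟩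
      rw [G.rev_rev] at h4
      exact h4 (hm.1 h3)
    · rw [e, G.rev_rev]
      rintro ⟨h3, h4⟩
      have h5 : x.1 ∉ S₁ := fun h => h4 (s.subset (hm.2 h))
      exact x.2.resolve_left h5 h3

/-- The spliced graph. -/
noncomputable def glue : RotationSystem s.Dart where
  rev := ⟨s.revFun, s.revFun, s.revFun_revFun, s.revFun_revFun⟩
  rot := G.rot.subtypePerm fun d => by rw [s.inv₁ d, s.inv₂ d]
  rev_rev := s.revFun_revFun
  rev_ne x := by
    change s.revFun x ≠ x
    rcases s.cases x with ⟨b, rfl⟩ | ⟨c, rfl⟩ | ⟨h1, h2⟩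
    · rw [revFun_ofBond]
      intro h
      exact (s.e b).2.2 (s.subset (by rw [show G.rev (s.e b).1 = b.1 from congrArg Subtype.val h]
                                      exact b.2.1))
    · rw [revFun_ofRevBond]
      intro h
      exact c.2.2 (s.subset (by
        rw [show G.rev c.1 = (s.e.symm c).1 from (congrArg Subtype.val h).symm]
        exact (s.e.symm c).2.1))
    · intro h
      exact G.rev_ne x.1 ((s.revFun_val h1 h2).symm.trans (congrArg Subtype.val h))

theorem rot_val (x : s.Dart) : (s.glue.rot x).1 = G.rot x.1 := rfl

theorem rev_ofBond (b : G.bond S₁) : s.glue.rev (s.ofBond b) = s.ofRevBond (s.e b) :=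
  s.revFun_ofBond b

theorem rev_ofRevBond (c : G.bond S₂) : s.glue.rev (s.ofRevBond c) = s.ofBond (s.e.symm c) :=
  s.revFun_ofRevBond c

theorem rev_val {x : s.Dart} (h : x.1 ∉ G.bond S₁) (h' : G.rev x.1 ∉ G.bond S₂) :
    (s.glue.rev x).1 = G.rev x.1 := s.revFun_val h h'

theorem next_val_eq (x : s.Dart) : (s.glue.next x).1 = G.rot⁻¹ (s.glue.rev x).1 := by
  rw [Equiv.Perm.eq_inv_iff_eq, ← rot_val, rot_next]

theorem next_ofBond (b : G.bond S₁) : (s.glue.next (s.ofBond b)).1 = G.next (s.e b).1 := by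
  rw [next_val_eq, rev_ofBond]; rfl

theorem next_ofRevBond (c : G.bond S₂) :
    (s.glue.next (s.ofRevBond c)).1 = G.next (G.rev (s.e.symm c).1) := by
  rw [next_val_eq, rev_ofRevBond, next_apply, G.rev_rev]; rfl

theorem next_val {x : s.Dart} (h : x.1 ∉ G.bond S₁) (h' : G.rev x.1 ∉ G.bond S₂) :
    (s.glue.next x).1 = G.next x.1 := by
  rw [next_val_eq, s.rev_val h h']; rfl

/-- A glued face is composed of two halves. Past the seam it follows the outer half of the face of
`e b`; the range starts at 1 because position 0 is still `b` itself. -/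
theorem iterate_next_out (b : G.bond S₁) {k : ℕ} (hk : 1 ≤ k) (hkr : k ≤ G.run S₁ b) :
    (s.glue.next^[k] (s.ofBond b)).1 = G.next^[k] (s.e b).1 := by
  induction k, hk using Nat.le_induction with
  | base => exact s.next_ofBond b
  | succ k hk ih =>
    have ih := ih (by omega)
    have h0 : G.next^[k] (s.e b).1 ∉ S₂ :=
      iterate_notMem_of_le_run hk (by rw [s.run_e]; omega)
    have h1 : G.next^[k + 1] (s.e b).1 ∉ S₂ :=
      iterate_notMem_of_le_run (by omega) (by rw [s.run_e]; omega)
    rw [Function.iterate_succ_apply', s.inv₂.next_iff] at h1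
    rw [Function.iterate_succ_apply', s.next_val, ih, Function.iterate_succ_apply']
    · rw [ih]; exact fun h => h0 (s.subset h.1)
    · rw [ih]; exact fun h => h1 h.1

/-- Since `e` respects `turn` and `run`, the outer half ends at the edge glued to `turn b`, and from
there the inner half of the face of `b` is resumed. -/
theorem iterate_next_in (b : G.bond S₁) {k : ℕ} (hk : G.run S₁ b < k)
    (hkp : k ≤ Function.minimalPeriod G.next b.1) :
    (s.glue.next^[k] (s.ofBond b)).1 = G.next^[k] b.1 := by
  have hmem : ∀ k, G.run S₁ b < k → k ≤ Function.minimalPeriod G.next b.1 →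
      G.next^[k] b.1 ∈ S₁ := fun k =>
    iterate_mem_of_run_lt s.acyclic s.inv₁ s.conn₁ s.conn₁_compl b.2
  induction k, hk using Nat.le_induction with
  | base =>
    have h1 := s.iterate_next_out b (run_pos s.inv₁ b.2) le_rfl
    have h2 : s.glue.next^[G.run S₁ b] (s.ofBond b) =
        s.ofRevBond (s.e ⟨G.turn S₁ b, turn_mem s.inv₁ b.2⟩) := by
      refine Subtype.ext (h1.trans ?_)
      change _ = G.rev (s.e _).1
      rw [s.turn_e b ⟨_, turn_mem s.inv₁ b.2⟩ rfl, rev_turn, s.run_e]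
    rw [Function.iterate_succ_apply', h2, next_ofRevBond, Equiv.symm_apply_apply, rev_turn,
      Function.iterate_succ_apply']
  | succ k hk ih =>
    have ih := ih (by omega)
    have h0 := hmem k hk (by omega)
    have h1 := hmem (k + 1) (by omega) hkp
    rw [Function.iterate_succ_apply', s.inv₁.next_iff] at h1
    rw [Function.iterate_succ_apply', s.next_val, ih, Function.iterate_succ_apply']
    · rw [ih]; exact fun h => h.2 h1
    · rw [ih]
      rintro ⟨-, h⟩
      rw [G.rev_rev] at h
      exact h (s.subset h0)

theorem minimalPeriod_ofBond (b : G.bond S₁) :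
    Function.minimalPeriod s.glue.next (s.ofBond b) = Function.minimalPeriod G.next b.1 := by
  have hrun := run_lt b.2
  have h1 : Function.IsPeriodicPt s.glue.next (Function.minimalPeriod G.next b.1) (s.ofBond b) :=
    Subtype.ext ((s.iterate_next_in b hrun le_rfl).trans Function.iterate_minimalPeriod)
  refine le_antisymm (h1.minimalPeriod_le (by omega)) ?_
  by_contra hlt
  rw [not_le] at hlt
  set m := Function.minimalPeriod s.glue.next (s.ofBond b) with hm
  have hpos : 1 ≤ m := Function.minimalPeriod_pos_of_mem_periodicPts (mem_periodicPts _ _)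
  have h2 : (s.glue.next^[m] (s.ofBond b)).1 = b.1 :=
    congrArg Subtype.val (Function.iterate_minimalPeriod (f := s.glue.next))
  rcases le_or_gt m (G.run S₁ b) with h | h
  · rw [s.iterate_next_out b hpos h] at h2
    refine iterate_notMem_of_le_run (S := S₂) hpos (by rw [s.run_e]; exact h) ?_
    rw [h2]; exact s.subset b.2.1
  · rw [s.iterate_next_in b h hlt.le] at h2
    have := Function.IsPeriodicPt.minimalPeriod_le (f := G.next) hpos h2
    omega

theorem exists_iterate_of_sameCycle {b : G.bond S₁} {x : s.Dart}
    (h : s.glue.next.SameCycle (s.ofBond b) x) :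
    ∃ k, k < Function.minimalPeriod G.next b.1 ∧ s.glue.next^[k] (s.ofBond b) = x := by
  obtain ⟨n, rfl⟩ := h.exists_iterate_eq
  refine ⟨n % Function.minimalPeriod s.glue.next (s.ofBond b), ?_,
    Function.iterate_mod_minimalPeriod_eq⟩
  rw [← s.minimalPeriod_ofBond b]
  exact Nat.mod_lt _ (Function.minimalPeriod_pos_of_mem_periodicPts (mem_periodicPts _ _))

theorem sameCycle_of_mem {b : G.bond S₁} {x : s.Dart}
    (h : s.glue.next.SameCycle (s.ofBond b) x) (hx : x.1 ∈ S₁) : G.next.SameCycle b.1 x.1 := by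
  obtain ⟨k, hk, rfl⟩ := s.exists_iterate_of_sameCycle h
  rcases Nat.eq_zero_or_pos k with rfl | h0
  · exact Equiv.Perm.SameCycle.refl _ _
  rcases le_or_gt k (G.run S₁ b) with h1 | h1
  · rw [s.iterate_next_out b h0 h1] at hx
    exact absurd (s.subset hx) (iterate_notMem_of_le_run h0 (by rw [s.run_e]; exact h1))
  · rw [s.iterate_next_in b h1 hk.le]
    exact sameCycle_iterate _ _ _

theorem eq_of_sameCycle_ofBond {b b' : G.bond S₁}
    (h : s.glue.next.SameCycle (s.ofBond b) (s.ofBond b')) : b = b' :=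
  Subtype.ext (bond_face_injective s.acyclic s.inv₁ s.conn₁ s.conn₁_compl b.2 b'.2
    (s.sameCycle_of_mem h b'.2.1))

theorem iterate_run_ofBond (b c : G.bond S₁) (hc : c.1 = G.turn S₁ b) :
    s.glue.next^[G.run S₁ b] (s.ofBond b) = s.ofRevBond (s.e c) := by
  refine Subtype.ext ((s.iterate_next_out b (run_pos s.inv₁ b.2) le_rfl).trans ?_)
  change _ = G.rev (s.e _).1
  rw [s.turn_e b c hc, rev_turn, s.run_e]

/-- A seam face comes back through the seam only at position `run`: earlier positions are followed
by a dart outside `S₂`, later ones lie in `S₁`. -/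
theorem eq_turn_of_sameCycle {b b' : G.bond S₁}
    (h : s.glue.next.SameCycle (s.ofBond b) (s.ofRevBond (s.e b'))) : b'.1 = G.turn S₁ b := by
  obtain ⟨k, hk, hx⟩ := s.exists_iterate_of_sameCycle h
  have hx' : (s.glue.next^[k] (s.ofBond b)).1 = G.rev (s.e b').1 := congrArg Subtype.val hx
  have hnot : G.rev (s.e b').1 ∉ S₂ := (s.e b').2.2
  rcases Nat.eq_zero_or_pos k with rfl | h0
  · exact absurd (s.subset b.2.1) (by
      rw [show b.1 = G.rev (s.e b').1 from hx']; exact hnot)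
  rcases le_or_gt k (G.run S₁ b) with h1 | h1
  · have hkr : k = G.run S₁ b := by
      by_contra hne
      refine iterate_notMem_of_le_run (G := G) (S := S₂) (d := (s.e b).1) (s := k + 1) (by omega)
        (by rw [s.run_e]; omega) ?_
      rw [Function.iterate_succ_apply', s.inv₂.next_iff, ← s.iterate_next_out b h0 h1, hx',
        G.rev_rev]
      exact (s.e b').2.1
    rw [hkr, s.iterate_run_ofBond b ⟨_, turn_mem s.inv₁ b.2⟩ rfl] at hx'
    have := s.e.injective (Subtype.ext (G.rev.injective hx'))
    rw [← this]
  · rw [s.iterate_next_in b h1 hk.le] at hx'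
    exact absurd (s.subset (iterate_mem_of_run_lt s.acyclic s.inv₁ s.conn₁ s.conn₁_compl b.2 h1
      hk.le)) (by rw [hx']; exact hnot)

theorem exists_turn_eq (s : G.Splice S₁ S₂) (b : G.bond S₁) : ∃ a : G.bond S₁, b.1 = G.turn S₁ a := by
  obtain ⟨a, ha⟩ :=
    (G.turnPerm S₁ s.acyclic s.inv₁ s.conn₁ s.conn₁_compl).surjective b
  exact ⟨a, (congrArg Subtype.val ha).symm⟩

/-- A face of the spliced graph that does not cross the seam is a face of the original graph. -/
theorem iterate_next_val {x : s.Dart} (hx : ∀ b, ¬ s.glue.next.SameCycle (s.ofBond b) x) (n : ℕ) :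
    (s.glue.next^[n] x).1 = G.next^[n] x.1 := by
  induction n with
  | zero => rfl
  | succ n ih =>
    rw [Function.iterate_succ_apply', Function.iterate_succ_apply', ← ih]
    have hy : ∀ b, ¬ s.glue.next.SameCycle (s.ofBond b) (s.glue.next^[n] x) := fun b h =>
      hx b (h.trans (sameCycle_iterate _ _ _).symm)
    rcases s.cases (s.glue.next^[n] x) with ⟨b, hb⟩ | ⟨c, hc⟩ | ⟨h1, h2⟩
    · exact absurd (hb ▸ Equiv.Perm.SameCycle.refl _ _) (hy b)
    -- Every reentry through the seam closes the outer half begun at some `a`, because `turn` is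
    -- onto the bond.
    · obtain ⟨a, ha⟩ := s.exists_turn_eq (s.e.symm c)
      refine absurd ?_ (hy a)
      rw [hc, ← s.e.apply_symm_apply c, ← s.iterate_run_ofBond a _ ha]
      exact sameCycle_iterate _ _ _
    · exact s.next_val h1 h2

/-- Both kept pieces are connected, and one glued edge joins them. -/
theorem glue_conn : s.glue.Conn Set.univ := by
  intro T hT hrev
  have hrev' : ∀ x, s.glue.rev x ∈ T ↔ x ∈ T := fun x =>
    ⟨fun h => by simpa [s.glue.rev_rev] using hrev _ trivial trivial h,
      hrev x trivial trivial⟩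
  have hTi : G.Invariant (Subtype.val '' T) := by
    intro d
    constructor
    · rintro ⟨x, hx, e⟩
      refine ⟨s.glue.rot.symm x, (hT _).1 (by simpa using hx), ?_⟩
      apply G.rot.injective
      rw [← e, ← rot_val, Equiv.apply_symm_apply]
    · rintro ⟨x, hx, rfl⟩
      exact ⟨s.glue.rot x, (hT x).2 hx, rfl⟩
  have hmem : ∀ x : s.Dart, x.1 ∈ Subtype.val '' T ↔ x ∈ T := fun x =>
    Function.Injective.mem_set_image Subtype.val_injective
  have h1 := s.conn₁ _ hTi (by
    rintro _ h1 h2 ⟨x, hx, rfl⟩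
    have e := s.rev_val (x := x) (fun h => h.2 h2)
      (fun h => h.2 (by rw [G.rev_rev]; exact s.subset h1))
    rw [← e, hmem, hrev']
    exact hx)
  have h2 := s.conn₂_compl _ hTi (by
    rintro _ h1 h2 ⟨x, hx, rfl⟩
    have e := s.rev_val (x := x) (fun h => h1 (s.subset h.1)) (fun h => h2 h.1)
    rw [← e, hmem, hrev']
    exact hx)
  obtain ⟨b, hb⟩ := s.nonempty
  have hb' := hrev' (s.ofBond ⟨b, hb⟩)
  rw [rev_ofBond] at hb'
  have ho : (s.ofRevBond (s.e ⟨b, hb⟩)).1 ∈ S₂ᶜ := (s.e ⟨b, hb⟩).2.2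
  have hi : (s.ofBond ⟨b, hb⟩).1 ∈ S₁ := hb.1
  rcases h1 with h1 | h1
  · left
    have hT2 := (hmem _).2 (hb'.2 ((hmem _).1 (h1 hi)))
    have h2 := h2.resolve_right fun h => h ho hT2
    intro x _
    rw [← hmem]
    exact x.2.elim (fun h => h1 h) fun h => h2 h
  · right
    have hT2 := fun h => h1 hi ((hmem _).2 (hb'.1 ((hmem _).1 h)))
    have h2 := h2.resolve_left fun h => hT2 (h ho)
    intro x _
    rw [Set.mem_compl_iff, ← hmem]
    exact x.2.elim (fun h => h1 h) fun h => h2 h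

theorem _root_.Fintype.sum_subtype_of_eq_zero {p : D → Prop} [Fintype (Subtype p)] (F : D → ℝ)
    (hF : ∀ d, ¬ p d → F d = 0) : ∑ x : Subtype p, F x = ∑ d, F d := by
  classical
  rw [← Finset.sum_subtype ({d | p d} : Finset D) (fun x => by simp) F, Finset.sum_filter]
  refine Finset.sum_congr rfl fun d _ => ?_
  split_ifs with h
  · rfl
  · exact (hF d h).symm

/-- Used for `S₁` and for the complement of `S₂`. A face function vanishing off such a side is zero
on all faces that cross the bond, so it remains a face function after gluing. -/
theorem exists_potential_in [Fintype s.Dart] {f : s.Dart → ℝ}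
    (hf : ∀ x, f (s.glue.rev x) = -f x)
    (hcoc : ∀ h : s.Dart → ℝ, (∀ x, h (s.glue.next x) = h x) → ∑ x, f x * h x = 0)
    {S : Set D} (hSi : G.Invariant S) (hS : G.Conn Sᶜ) (hsub : ∀ d ∈ S, d ∈ S₁ ∨ d ∉ S₂)
    (hrev : ∀ x : s.Dart, x.1 ∈ S → G.rev x.1 ∈ S → (s.glue.rev x).1 = G.rev x.1)
    (hinv : ∀ h : D → ℝ, (∀ d, h (G.next d) = h d) → (∀ d ∉ S, h d = 0) →
      ∀ x : s.Dart, h (s.glue.next x).1 = h x.1) :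
    ∃ g : D → ℝ, (∀ d, g (G.rot d) = g d) ∧
      ∀ x : s.Dart, x.1 ∈ S → G.rev x.1 ∈ S → f x = g (G.rev x.1) - g x.1 := by
  classical
  have : Nonempty D := ⟨s.nonempty.some⟩
  let F : D → ℝ := fun d => if h : d ∈ S ∧ G.rev d ∈ S then f ⟨d, hsub d h.1⟩ else 0
  have hF : ∀ x : s.Dart, x.1 ∈ S → G.rev x.1 ∈ S → F x.1 = f x := fun x h1 h2 =>
    dif_pos ⟨h1, h2⟩
  have hF0 : ∀ d, ¬(d ∈ S ∧ G.rev d ∈ S) → F d = 0 := fun d h => dif_neg h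
  obtain ⟨g, hg1, hg2⟩ := exists_potential_on s.acyclic s.conn hSi hS F
    (fun d => by
      by_cases h : d ∈ S ∧ G.rev d ∈ S
      · have e := hrev ⟨d, hsub d h.1⟩ h.1 h.2
        rw [hF ⟨d, hsub d h.1⟩ h.1 h.2, ← hf]
        refine (congrArg F e.symm).trans (hF _ ?_ ?_)
        · rw [e]; exact h.2
        · rw [e, G.rev_rev]; exact h.1
      · rw [hF0 d h, hF0, neg_zero]
        rw [G.rev_rev]
        exact fun h' => h h'.symm)
    hF0 (fun h hh hh0 => by
      rw [← hcoc (fun x => h x.1) (hinv h hh hh0),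
        ← Fintype.sum_subtype_of_eq_zero (p := fun d => d ∈ S₁ ∨ d ∉ S₂)]
      · refine Finset.sum_congr rfl fun x _ => ?_
        by_cases h1 : x.1 ∈ S
        · by_cases h2 : G.rev x.1 ∈ S
          · rw [hF x h1 h2]
          · rw [← hh, hh0 (G.next x.1) (by rwa [hSi.next_iff])]
            simp
        · simp [hh0 _ h1]
      · intro d hd
        rw [hF0 d fun h => hd (hsub d h.1), zero_mul])
  exact ⟨g, hg1, fun x h1 h2 => by rw [← hF x h1 h2, hg2 x.1 h1 h2]⟩

/-- Subtracting potentials found on the two sides leaves a function `u` carried by the glued edges.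
Each seam face meets two of them, consecutive under `turn`, so `u` is constant along the seam and is
the coboundary of a step function. -/
theorem glue_acyclic [Fintype s.Dart] : s.glue.Acyclic := by
  classical
  intro f hf hcoc
  have hout : ∀ b : G.bond S₁, G.next (s.e b).1 ∉ S₂ := fun b => by
    rw [s.inv₂.next_iff]; exact (s.e b).2.2
  have hout₁ : ∀ b : G.bond S₁, G.next b.1 ∉ S₁ := fun b => by
    rw [s.inv₁.next_iff]; exact b.2.2
  have hin : ∀ c : G.bond S₂, G.next (G.rev (s.e.symm c).1) ∈ S₁ := fun c => by
    rw [s.inv₁.next_iff, G.rev_rev]; exact (s.e.symm c).2.1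
  have hin₂ : ∀ c : G.bond S₂, G.next (G.rev c.1) ∈ S₂ := fun c => by
    rw [s.inv₂.next_iff, G.rev_rev]; exact c.2.1
  obtain ⟨g₁, hg₁, hg₁'⟩ := s.exists_potential_in hf hcoc s.inv₁ s.conn₁_compl
    (fun d hd => Or.inl hd)
    (fun x h1 h2 => s.rev_val (fun h => h.2 h2)
      (fun h => h.2 (by rw [G.rev_rev]; exact s.subset h1)))
    (fun h hh hh0 x => by
      rcases s.cases x with ⟨b, rfl⟩ | ⟨c, rfl⟩ | ⟨h1, h2⟩
      · rw [next_ofBond, hh0 _ fun h => hout b (s.subset h)]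
        exact ((hh b.1).symm.trans (hh0 _ (hout₁ b))).symm
      · rw [next_ofRevBond, hh, hh0 _ (s.e.symm c).2.2]
        exact (hh0 _ fun h => c.2.2 (s.subset h)).symm
      · rw [s.next_val h1 h2, hh])
  obtain ⟨g₂, hg₂, hg₂'⟩ := s.exists_potential_in (S := S₂ᶜ) hf hcoc s.inv₂.compl
    (by rw [compl_compl]; exact s.conn₂)
    (fun d hd => Or.inr hd)
    (fun x h1 h2 => s.rev_val (fun h => h1 (s.subset h.1)) (fun h => h2 h.1))
    (fun h hh hh0 x => by
      rcases s.cases x with ⟨b, rfl⟩ | ⟨c, rfl⟩ | ⟨h1, h2⟩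
      · rw [next_ofBond, hh, hh0 _ (not_not.2 (s.e b).2.1)]
        exact (hh0 _ (not_not.2 (s.subset b.2.1))).symm
      · rw [next_ofRevBond, hh0 _ (not_not.2 (s.subset (hin c)))]
        exact ((hh _).symm.trans (hh0 _ (not_not.2 (hin₂ c)))).symm
      · rw [s.next_val h1 h2, hh])
  let g₀ : s.Dart → ℝ := fun x => if x.1 ∈ S₁ then g₁ x.1 else g₂ x.1
  have hg₀ : ∀ x, g₀ (s.glue.rot x) = g₀ x := fun x => by
    simp only [g₀, rot_val, s.inv₁ x.1, hg₁, hg₂]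
  let u : s.Dart → ℝ := fun x => f x - (g₀ (s.glue.rev x) - g₀ x)
  have hu : ∀ x, u (s.glue.rev x) = -u x := fun x => by
    simp only [u, hf, s.glue.rev_rev]; ring
  have hucoc : ∀ h : s.Dart → ℝ, (∀ x, h (s.glue.next x) = h x) → ∑ x, u x * h x = 0 := by
    intro h hh
    simp only [u, sub_mul (f _), Finset.sum_sub_distrib, hcoc h hh, sum_grad_mul_eq_zero hg₀ hh,
      sub_zero]
  have hu0 : ∀ x : s.Dart, x.1 ∉ G.bond S₁ → G.rev x.1 ∉ G.bond S₂ → u x = 0 := by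
    intro x h1 h2
    have e := s.rev_val h1 h2
    have hm := s.revFun_mem_iff h1 h2
    by_cases hx : x.1 ∈ S₁
    · simp only [u, g₀, e, hm.2 hx, hx, if_true]
      rw [hg₁' x hx (hm.2 hx), sub_self]
    · have hx' : G.rev x.1 ∉ S₁ := fun h => hx (hm.1 h)
      have k1 : x.1 ∉ S₂ := x.2.resolve_left hx
      have k2 : G.rev x.1 ∉ S₂ := fun h => h2 ⟨h, by rwa [G.rev_rev]⟩
      simp only [u, g₀, e, hx, hx', if_false]
      rw [hg₂' x k1 k2, sub_self]
  have hpair : ∀ h : s.Dart → ℝ, ∑ x, u x * h x =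
      ∑ b, u (s.ofBond b) * (h (s.ofBond b) - h (s.ofRevBond (s.e b))) := by
    intro h
    have e1 : ∀ x, u x * h x = ∑ b, ((if x = s.ofBond b then u (s.ofBond b) * h (s.ofBond b) else 0)
        - (if x = s.ofRevBond (s.e b) then u (s.ofBond b) * h (s.ofRevBond (s.e b)) else 0)) := by
      intro x
      have hne : ∀ b c, s.ofBond b ≠ s.ofRevBond c := fun b c h =>
        c.2.2 (s.subset (by
          rw [show G.rev c.1 = b.1 from (congrArg Subtype.val h).symm]; exact b.2.1))
      have hinj : ∀ b b', s.ofBond b = s.ofBond b' ↔ b = b' := fun b b' =>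
        ⟨fun h => Subtype.ext (congrArg (fun x : s.Dart => x.1) h), fun h => by rw [h]⟩
      have hinj' : ∀ c c', s.ofRevBond c = s.ofRevBond c' ↔ c = c' := fun b b' =>
        ⟨fun h => Subtype.ext (G.rev.injective (congrArg (fun x : s.Dart => x.1) h)),
          fun h => by rw [h]⟩
      rcases s.cases x with ⟨b, rfl⟩ | ⟨c, rfl⟩ | ⟨h1, h2⟩
      · simp [hne, hinj]
      · obtain ⟨b, rfl⟩ := s.e.surjective c
        have := hu (s.ofBond b)
        rw [rev_ofBond] at this
        simp [fun b c => (hne b c).symm, hinj', this]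
      · rw [hu0 x h1 h2, zero_mul]
        symm
        refine Finset.sum_eq_zero fun b _ => ?_
        rw [if_neg, if_neg, sub_zero]
        · rintro rfl
          exact h2 (by rw [show G.rev (s.ofRevBond (s.e b)).1 = (s.e b).1 from G.rev_rev _]
                       exact (s.e b).2)
        · rintro rfl
          exact h1 b.2
    rw [Finset.sum_congr rfl fun x _ => e1 x, Finset.sum_comm]
    refine Finset.sum_congr rfl fun b _ => ?_
    simp [Finset.sum_sub_distrib, mul_sub]
  have hstep : ∀ b c : G.bond S₁, c.1 = G.turn S₁ b → u (s.ofBond c) = u (s.ofBond b) := by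
    intro b c hbc
    -- The test function is the indicator of the seam face through `b`.
    have := hucoc (fun x => if s.glue.next.SameCycle (s.ofBond b) x then 1 else 0)
      (fun x => by simp only [Equiv.Perm.sameCycle_apply_right])
    rw [hpair] at this
    have k1 : ∀ b', s.glue.next.SameCycle (s.ofBond b) (s.ofBond b') ↔ b' = b := fun b' =>
      ⟨fun h => (s.eq_of_sameCycle_ofBond h).symm, fun h => h ▸ Equiv.Perm.SameCycle.refl _ _⟩
    have k2 : ∀ b', s.glue.next.SameCycle (s.ofBond b) (s.ofRevBond (s.e b')) ↔ b' = c :=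
      fun b' => ⟨fun h => Subtype.ext ((s.eq_turn_of_sameCycle h).trans hbc.symm), fun h => by
        rw [h, ← s.iterate_run_ofBond b c hbc]; exact sameCycle_iterate _ _ _⟩
    simp only [k1, k2, mul_sub, mul_ite, mul_one, mul_zero, Finset.sum_sub_distrib,
      Finset.sum_ite_eq', Finset.mem_univ, if_true] at this
    linarith
  obtain ⟨b₀, hb₀⟩ := s.nonempty
  have hconst : ∀ b, u (s.ofBond b) = u (s.ofBond ⟨b₀, hb₀⟩) := fun b =>
    eq_of_sameCycle (h := fun b => u (s.ofBond b))
      (fun d => hstep d _ rfl)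
      (turnPerm_sameCycle s.acyclic s.inv₁ s.conn₁ s.conn₁_compl b ⟨b₀, hb₀⟩)
  set c := u (s.ofBond ⟨b₀, hb₀⟩)
  refine ⟨fun x => g₀ x + if x.1 ∈ S₁ then 0 else c, fun x => ?_, fun x => ?_⟩
  · simp only [hg₀, rot_val, s.inv₁ x.1]
  · have hfx : f x = u x + (g₀ (s.glue.rev x) - g₀ x) := by simp only [u]; ring
    have key : u x = (if (s.glue.rev x).1 ∈ S₁ then 0 else c) - if x.1 ∈ S₁ then 0 else c := by
      rcases s.cases x with ⟨b, rfl⟩ | ⟨d, rfl⟩ | ⟨h1, h2⟩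
      · have k1 : (s.ofBond b).1 ∈ S₁ := b.2.1
        have k2 : (s.ofRevBond (s.e b)).1 ∉ S₁ := fun h => (s.e b).2.2 (s.subset h)
        rw [rev_ofBond, if_neg k2, if_pos k1, hconst, sub_zero]
      · obtain ⟨b, rfl⟩ := s.e.surjective d
        have k1 : (s.ofBond b).1 ∈ S₁ := b.2.1
        have k2 : (s.ofRevBond (s.e b)).1 ∉ S₁ := fun h => (s.e b).2.2 (s.subset h)
        rw [rev_ofRevBond, Equiv.symm_apply_apply, if_neg k2, if_pos k1, ← rev_ofBond, hu, hconst,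
          zero_sub]
      · rw [hu0 x h1 h2]
        simp only [s.rev_val h1 h2, s.revFun_mem_iff h1 h2, sub_self]
    rw [hfx, key]
    ring

end Splice

end RotationSystem

/-! ### Cutting out the part of an annular diagram between two bonds -/

namespace RotationSystem.Splice

variable {D : Type*} {G : RotationSystem D} [Fintype D] {S₁ S₂ : Set D} (s : G.Splice S₁ S₂)

theorem sameCycle_val_of_forall {x y : s.Dart}
    (hx : ∀ b, ¬ s.glue.next.SameCycle (s.ofBond b) x) :
    s.glue.next.SameCycle x y ↔ G.next.SameCycle x.1 y.1 := by
  constructor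
  · intro h
    obtain ⟨n, rfl⟩ := h.exists_iterate_eq
    rw [s.iterate_next_val hx]
    exact sameCycle_iterate _ _ _
  · intro h
    obtain ⟨n, hn⟩ := h.exists_iterate_eq
    rw [← s.iterate_next_val hx] at hn
    rw [← Subtype.ext hn]
    exact sameCycle_iterate _ _ _

theorem sameCycle_ofBond_of_mem {b : G.bond S₁} {x : s.Dart} (hx : x.1 ∈ S₁)
    (h : G.next.SameCycle b.1 x.1) : s.glue.next.SameCycle (s.ofBond b) x := by
  obtain ⟨k, hk, e⟩ := exists_iterate_lt_of_sameCycle h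
  rcases Nat.eq_zero_or_pos k with rfl | h0
  · rw [show x = s.ofBond b from Subtype.ext e.symm]
  rcases le_or_gt k (G.run S₁ b) with h1 | h1
  · rw [← e] at hx
    exact absurd hx (iterate_notMem_of_le_run h0 h1)
  · rw [← s.iterate_next_in b h1 hk.le] at e
    rw [← Subtype.ext e]
    exact sameCycle_iterate _ _ _

theorem sameCycle_ofBond_of_notMem {b : G.bond S₁} {x : s.Dart} (hx : x.1 ∉ S₂)
    (h : G.next.SameCycle (s.e b).1 x.1) : s.glue.next.SameCycle (s.ofBond b) x := by
  obtain ⟨k, hk, e⟩ := exists_iterate_lt_of_sameCycle h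
  rcases Nat.eq_zero_or_pos k with rfl | h0
  · exact absurd (s.e b).2.1 (by rw [show (s.e b).1 = x.1 from e]; exact hx)
  rcases le_or_gt k (G.run S₁ b) with h1 | h1
  · rw [← s.iterate_next_out b h0 h1] at e
    rw [← Subtype.ext e]
    exact sameCycle_iterate _ _ _
  · exact absurd (iterate_mem_of_run_lt s.acyclic s.inv₂ s.conn₂ s.conn₂_compl (s.e b).2
      (by rw [s.run_e]; exact h1) hk.le) (by rw [e]; exact hx)

theorem sameCycle_of_notMem {b : G.bond S₁} {x : s.Dart}
    (h : s.glue.next.SameCycle (s.ofBond b) x) (hx : x.1 ∉ S₂) :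
    G.next.SameCycle (s.e b).1 x.1 := by
  obtain ⟨k, hk, rfl⟩ := s.exists_iterate_of_sameCycle h
  rcases Nat.eq_zero_or_pos k with rfl | h0
  · exact absurd (s.subset b.2.1) hx
  rcases le_or_gt k (G.run S₁ b) with h1 | h1
  · rw [s.iterate_next_out b h0 h1]
    exact sameCycle_iterate _ _ _
  · rw [s.iterate_next_in b h1 hk.le] at hx
    exact absurd (s.subset (iterate_mem_of_run_lt s.acyclic s.inv₁ s.conn₁ s.conn₁_compl b.2
      h1 hk.le)) hx

/-- Gluing does not split the inner part of a face, since a face has at most one inner arc. -/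
theorem sameCycle_of_mem_mem {x y : s.Dart} (hx : x.1 ∈ S₁) (hy : y.1 ∈ S₁)
    (h : G.next.SameCycle x.1 y.1) : s.glue.next.SameCycle x y := by
  by_cases hb : ∃ b : G.bond S₁, s.glue.next.SameCycle (s.ofBond b) x
  · obtain ⟨b, hb⟩ := hb
    exact hb.symm.trans (s.sameCycle_ofBond_of_mem hy ((s.sameCycle_of_mem hb hx).trans h))
  · exact (s.sameCycle_val_of_forall (not_exists.1 hb)).2 h

theorem periodicOrbit_map_of_forall {α : Type*} (l : D → α) {x : s.Dart}
    (hx : ∀ b, ¬ s.glue.next.SameCycle (s.ofBond b) x) :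
    (Function.periodicOrbit s.glue.next x).map (fun y => l y.1) =
      (Function.periodicOrbit G.next x.1).map l := by
  have hp : Function.minimalPeriod s.glue.next x = Function.minimalPeriod G.next x.1 :=
    Function.minimalPeriod_eq_minimalPeriod_iff.2 fun n => by
      rw [Function.IsPeriodicPt, Function.IsPeriodicPt, Function.IsFixedPt, Function.IsFixedPt,
        ← s.iterate_next_val hx, Subtype.ext_iff]
  rw [Function.periodicOrbit_def, Function.periodicOrbit_def, Cycle.map_coe, Cycle.map_coe, hp,
    List.map_map, List.map_map]
  congr 2
  funext k
  simp [s.iterate_next_val hx]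

end RotationSystem.Splice

/-! ### Sphere maps as connected acyclic rotation systems -/

namespace SphereMap

variable (M : SphereMap)

/-- The rotation system of a map on the sphere. -/
def toRotationSystem : RotationSystem M.Dart := ⟨M.rev, M.rot, M.rev_rev, M.rev_ne⟩

theorem toRotationSystem_conn : M.toRotationSystem.Conn Set.univ := by
  intro T hT hrev
  have hrev' : ∀ d, M.rev d ∈ T ↔ d ∈ T := fun d =>
    ⟨fun h => by have := hrev _ trivial trivial h
                 rwa [show M.toRotationSystem.rev (M.rev d) = d from M.rev_rev d] at this,
      hrev d trivial trivial⟩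
  have hg : ∀ g ∈ Subgroup.closure {M.rev, M.rot}, ∀ d, g d ∈ T ↔ d ∈ T := by
    intro g hg
    induction hg using Subgroup.closure_induction with
    | mem g hg =>
      rcases hg with rfl | rfl
      · exact hrev'
      · exact hT
    | one => exact fun d => Iff.rfl
    | mul g h _ _ ihg ihh => exact fun d => (ihg _).trans (ihh d)
    | inv g _ ih => exact fun d => by rw [← ih]; simp
  obtain ⟨d⟩ := M.nonempty_dart
  by_cases hd : d ∈ T
  · left
    intro e _
    obtain ⟨g, h, rfl⟩ := M.connected d e
    exact (hg g h d).2 hd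
  · right
    intro e _
    obtain ⟨g, h, rfl⟩ := M.connected d e
    exact fun h' => hd ((hg g h d).1 h')

theorem toRotationSystem_acyclic [Fintype M.Dart] : M.toRotationSystem.Acyclic :=
  have := M.nonempty_dart
  (M.toRotationSystem.euler_iff_acyclic M.toRotationSystem_conn).1 M.euler

theorem face_eq_iff {M : SphereMap} {d e : M.Dart} :
    M.face d = M.face e ↔ M.toRotationSystem.next.SameCycle d e :=
  Quotient.eq (r := Equiv.Perm.SameCycle.setoid M.next)

theorem tail_eq_iff {M : SphereMap} {d e : M.Dart} :
    M.tail d = M.tail e ↔ M.rot.SameCycle d e :=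
  Quotient.eq (r := Equiv.Perm.SameCycle.setoid M.rot)

theorem face_next {M : SphereMap} (d : M.Dart) : M.face (M.toRotationSystem.next d) = M.face d :=
  RotationSystem.mk_perm M.next d

end SphereMap

/-- A connected acyclic rotation system is a map on the sphere. -/
def RotationSystem.toSphereMap {D : Type} [Fintype D] [Nonempty D] (G : RotationSystem D)
    (hc : G.Conn Set.univ) (hA : G.Acyclic) : SphereMap where
  Dart := D
  finite_dart := inferInstance
  nonempty_dart := inferInstance
  rev := G.rev
  rev_rev := G.rev_rev
  rev_ne := G.rev_ne
  rot := G.rot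
  connected d e := by
    have h1 : G.rev ∈ Subgroup.closure {G.rev, G.rot} := Subgroup.subset_closure (by simp)
    have h2 : G.rot ∈ Subgroup.closure {G.rev, G.rot} := Subgroup.subset_closure (by simp)
    rcases hc {e | ∃ g ∈ Subgroup.closure {G.rev, G.rot}, g d = e} (fun e => by
        constructor
        · rintro ⟨g, hg, h⟩
          exact ⟨G.rot⁻¹ * g, mul_mem (inv_mem h2) hg, by
            rw [Equiv.Perm.mul_apply, h]; exact G.rot.symm_apply_apply e⟩
        · rintro ⟨g, hg, rfl⟩
          exact ⟨G.rot * g, mul_mem h2 hg, rfl⟩)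
      (by
        rintro e - - ⟨g, hg, rfl⟩
        exact ⟨G.rev * g, mul_mem h1 hg, rfl⟩) with h | h
    · exact h (Set.mem_univ e)
    · exact absurd ⟨1, one_mem _, rfl⟩ (h (Set.mem_univ d))
  euler := (G.euler_iff_acyclic hc).2 hA

/-! ### The diagram obtained by cutting and gluing -/

namespace AnnularDiagram

open RotationSystem

variable {X : Type*} {R : Set (GroupWord X)} (Δ : AnnularDiagram R)

/-- The word read along the contour of the face to the left of `d`, starting with `d`. -/
noncomputable def contourWord (d : Δ.Dart) : GroupWord X :=
  (List.range (Function.minimalPeriod Δ.next d)).map fun k => Δ.label (Δ.next^[k] d)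

theorem contourLabel_eq_contourWord (d : Δ.Dart) :
    Δ.contourLabel d = (Δ.contourWord d : Cycle (X × Bool)) := by
  rw [contourLabel, Function.periodicOrbit_def, Cycle.map_coe, List.map_map]
  rfl

theorem exists_face_eq (f : Δ.Face) : ∃ d, Δ.face d = f := Quotient.exists_rep f

instance : Finite Δ.Dart := Δ.finite_dart

instance : Nonempty Δ.Dart := Δ.nonempty_dart

instance : Finite Δ.Face := Quotient.finite _

theorem face_ne_of_mem_bond {Δ : AnnularDiagram R} {S : Set Δ.Dart} (hS : Δ.toRotationSystem.Invariant S)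
    (hin : ∀ d, Δ.face d = Δ.inner → d ∈ S) (hout : ∀ d, Δ.face d = Δ.outer → d ∉ S)
    {b : Δ.Dart} (hb : b ∈ Δ.toRotationSystem.bond S) :
    Δ.face b ≠ Δ.inner ∧ Δ.face b ≠ Δ.outer :=
  ⟨fun h => hb.2 ((hS.next_iff b).1 (hin _ ((SphereMap.face_next b).trans h))),
    fun h => hout b h hb.1⟩

theorem contourLabel_eq_of_face_eq {Δ : AnnularDiagram R} {d d' : Δ.Dart} (h : Δ.face d = Δ.face d') :
    Δ.contourLabel d = Δ.contourLabel d' := by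
  obtain ⟨n, rfl⟩ := (SphereMap.face_eq_iff.1 h).exists_iterate_eq
  exact congrArg (Cycle.map Δ.label)
    (Function.periodicOrbit_apply_iterate_eq (mem_periodicPts Δ.next d) n).symm

/-- Two nested bonds of a diagram, separating the holes, that are crossed by cells in the same
pattern and not crossed by a common cell. -/
structure Splice [Fintype Δ.Dart] (S₁ S₂ : Set Δ.Dart) extends
    Δ.toRotationSystem.Splice S₁ S₂ where
  inner_mem : ∀ d, Δ.face d = Δ.inner → d ∈ S₁
  outer_notMem : ∀ d, Δ.face d = Δ.outer → d ∉ S₂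
  separated : ∀ x ∈ S₁, ∀ y ∉ S₂, Δ.face x ≠ Δ.face y
  contourWord_e : ∀ b, Δ.contourWord (e b).1 = Δ.contourWord b.1

namespace Splice

variable {Δ} [Fintype Δ.Dart] {S₁ S₂ : Set Δ.Dart} (s : Δ.Splice S₁ S₂)

theorem face_ofBond_ne (s : Δ.Splice S₁ S₂) (b : Δ.toRotationSystem.bond S₁) :
    Δ.face b.1 ≠ Δ.inner ∧ Δ.face b.1 ≠ Δ.outer :=
  face_ne_of_mem_bond s.inv₁ s.inner_mem (fun d hd h => s.outer_notMem d hd (s.subset h)) b.2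

theorem face_e_ne (b : Δ.toRotationSystem.bond S₁) :
    Δ.face (s.e b).1 ≠ Δ.inner ∧ Δ.face (s.e b).1 ≠ Δ.outer :=
  face_ne_of_mem_bond s.inv₂ (fun d hd => s.subset (s.inner_mem d hd)) s.outer_notMem (s.e b).2

theorem label_e (b : Δ.toRotationSystem.bond S₁) {k : ℕ}
    (hk : k < Function.minimalPeriod Δ.next b.1) :
    Δ.label (Δ.next^[k] (s.e b).1) = Δ.label (Δ.next^[k] b.1) := by
  have h := s.contourWord_e b
  have hp : Function.minimalPeriod Δ.next (s.e b).1 = Function.minimalPeriod Δ.next b.1 :=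
    s.period_e b
  rw [contourWord, contourWord, hp] at h
  exact (List.map_inj_left.1 h) k (List.mem_range.2 hk)

/-- Both bonds cross cells only, so the seam leaves the holes untouched. -/
theorem not_sameCycle_of_hole {x : s.Dart} (hx : Δ.face x.1 = Δ.inner ∨ Δ.face x.1 = Δ.outer)
    (b : Δ.toRotationSystem.bond S₁) : ¬ s.glue.next.SameCycle (s.ofBond b) x := by
  intro h
  rcases x.2 with h1 | h1
  · have := SphereMap.face_eq_iff.2 (s.sameCycle_of_mem h h1)
    rw [← this] at hx
    exact hx.elim (s.face_ofBond_ne b).1 (s.face_ofBond_ne b).2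
  · have := SphereMap.face_eq_iff.2 (s.sameCycle_of_notMem h h1)
    rw [← this] at hx
    exact hx.elim (s.face_e_ne b).1 (s.face_e_ne b).2

/-- The cells of `b` and of `e b` read the same word, so replacing the outer half of the first by
that of the second changes no letter. -/
theorem contourLabel_ofBond (b : Δ.toRotationSystem.bond S₁) :
    (Function.periodicOrbit s.glue.next (s.ofBond b)).map (fun y => Δ.label y.1) =
      Δ.contourLabel b.1 := by
  rw [contourLabel_eq_contourWord, contourWord, Function.periodicOrbit_def, Cycle.map_coe,
    List.map_map, s.minimalPeriod_ofBond]
  refine congrArg _ (List.map_congr_left fun k hk => ?_)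
  rw [List.mem_range] at hk
  rw [Function.comp_apply]
  rcases Nat.eq_zero_or_pos k with rfl | h0
  · rfl
  rcases le_or_gt k (Δ.toRotationSystem.run S₁ b) with h1 | h1
  · rw [s.iterate_next_out b h0 h1]
    exact s.label_e b hk
  · rw [s.iterate_next_in b h1 hk.le]
    rfl

theorem exists_inner (Δ : AnnularDiagram R) : ∃ d, Δ.face d = Δ.inner := Δ.exists_face_eq _

theorem exists_outer (Δ : AnnularDiagram R) : ∃ d, Δ.face d = Δ.outer := Δ.exists_face_eq _

instance : Nonempty s.Dart := ⟨s.ofBond ⟨_, s.nonempty.some_mem⟩⟩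

/-- The underlying map of the spliced diagram. -/
noncomputable def map : SphereMap :=
  letI := Fintype.ofFinite s.Dart
  s.glue.toSphereMap s.glue_conn s.glue_acyclic

/-- A dart on the contour of the inner hole. -/
noncomputable def innerDart : s.map.Dart :=
  ⟨(exists_inner Δ).choose, Or.inl (s.inner_mem _ (exists_inner Δ).choose_spec)⟩

/-- A dart on the contour of the outer hole. -/
noncomputable def outerDart : s.map.Dart :=
  ⟨(exists_outer Δ).choose, Or.inr (s.outer_notMem _ (exists_outer Δ).choose_spec)⟩

/-- The dart of the original diagram. -/
def val (x : s.map.Dart) : Δ.Dart := Subtype.val (p := fun d => d ∈ S₁ ∨ d ∉ S₂) x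

theorem map_face_eq_iff {x y : s.map.Dart} :
    s.map.face x = s.map.face y ↔ s.glue.next.SameCycle x y := SphereMap.face_eq_iff

theorem face_eq_hole_iff {h : s.map.Dart} (hh : Δ.face (s.val h) = Δ.inner ∨
    Δ.face (s.val h) = Δ.outer) {x : s.map.Dart} :
    s.map.face x = s.map.face h ↔ Δ.face (s.val x) = Δ.face (s.val h) := by
  rw [eq_comm, map_face_eq_iff, eq_comm, SphereMap.face_eq_iff]
  exact s.sameCycle_val_of_forall (s.not_sameCycle_of_hole hh)

theorem face_innerDart : Δ.face (s.val s.innerDart) = Δ.inner := (exists_inner Δ).choose_spec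

theorem face_outerDart : Δ.face (s.val s.outerDart) = Δ.outer := (exists_outer Δ).choose_spec

theorem face_eq_inner_iff {x : s.map.Dart} :
    s.map.face x = s.map.face s.innerDart ↔ Δ.face (s.val x) = Δ.inner := by
  rw [s.face_eq_hole_iff (Or.inl s.face_innerDart), face_innerDart]

theorem face_eq_outer_iff {x : s.map.Dart} :
    s.map.face x = s.map.face s.outerDart ↔ Δ.face (s.val x) = Δ.outer := by
  rw [s.face_eq_hole_iff (Or.inr s.face_outerDart), face_outerDart]

/-- The diagram obtained by cutting out the part between the two bonds. -/
noncomputable def diagram : AnnularDiagram R where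
  toSphereMap := s.map
  label x := Δ.label (s.val x)
  label_rev x := by
    -- Equal contour words have equal first letters, so glued edges carry consistent labels.
    have h0 : ∀ b, Δ.label (s.e b).1 = Δ.label b.1 := fun b => s.label_e b
      (Function.minimalPeriod_pos_of_mem_periodicPts (mem_periodicPts Δ.next b.1))
    rcases s.cases x with ⟨b, rfl⟩ | ⟨c, rfl⟩ | ⟨h1, h2⟩
    · have e : s.val (s.map.rev (s.ofBond b)) = Δ.rev (s.e b).1 :=
        congrArg s.val (s.rev_ofBond b)
      rw [e, Δ.label_rev, h0]
      rfl
    · obtain ⟨b, rfl⟩ := s.e.surjective c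
      have e : s.val (s.map.rev (s.ofRevBond (s.e b))) = b.1 :=
        (congrArg s.val (s.rev_ofRevBond (s.e b))).trans (by rw [Equiv.symm_apply_apply]; rfl)
      have e' : s.val (s.ofRevBond (s.e b)) = Δ.rev (s.e b).1 := rfl
      rw [e, e', Δ.label_rev, h0]
      simp
    · have e : s.val (s.map.rev x) = Δ.rev (s.val x) := s.rev_val h1 h2
      rw [e, Δ.label_rev]
  inner := s.map.face s.innerDart
  outer := s.map.face s.outerDart
  inner_ne_outer h := Δ.inner_ne_outer (by
    rw [s.face_eq_outer_iff, face_innerDart] at h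
    exact h)
  cell_label x hi ho := by
    by_cases hb : ∃ b, s.glue.next.SameCycle (s.ofBond b) x
    · obtain ⟨b, hb⟩ := hb
      obtain ⟨n, rfl⟩ := hb.exists_iterate_eq
      have e : (Function.periodicOrbit s.map.next (s.glue.next^[n] (s.ofBond b))).map
          (fun y => Δ.label (s.val y)) = Δ.contourLabel b.1 :=
        (congrArg _ (Function.periodicOrbit_apply_iterate_eq
          (mem_periodicPts s.glue.next (s.ofBond b)) n)).trans
          (s.contourLabel_ofBond b)
      rw [e]
      exact Δ.cell_label b.1 (s.face_ofBond_ne b).1 (s.face_ofBond_ne b).2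
    · have e : (Function.periodicOrbit s.map.next x).map (fun y => Δ.label (s.val y)) =
          Δ.contourLabel (s.val x) := s.periodicOrbit_map_of_forall Δ.label (not_exists.1 hb)
      rw [e]
      exact Δ.cell_label _ (fun h => hi (s.face_eq_inner_iff.2 h))
        fun h => ho (s.face_eq_outer_iff.2 h)

theorem contourLabel_diagram {x : s.map.Dart}
    (hx : Δ.face (s.val x) = Δ.inner ∨ Δ.face (s.val x) = Δ.outer) :
    s.diagram.contourLabel x = Δ.contourLabel (s.val x) :=
  s.periodicOrbit_map_of_forall Δ.label (s.not_sameCycle_of_hole hx)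

theorem sameBoundaryLabels : Δ.SameBoundaryLabels s.diagram := by
  constructor
  · intro d x hd hx
    have h := s.face_eq_inner_iff.1 hx
    rw [s.contourLabel_diagram (Or.inl h)]
    exact contourLabel_eq_of_face_eq (hd.trans h.symm)
  · intro d x hd hx
    have h := s.face_eq_outer_iff.1 hx
    rw [s.contourLabel_diagram (Or.inr h)]
    exact contourLabel_eq_of_face_eq (hd.trans h.symm)

theorem tail_val {x y : s.map.Dart} (h : s.map.tail x = s.map.tail y) :
    Δ.tail (s.val x) = Δ.tail (s.val y) :=
  SphereMap.tail_eq_iff.2 ((Equiv.Perm.sameCycle_subtypePerm (f := Δ.rot)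
    (h := fun d => or_congr (s.inv₁ d) (not_congr (s.inv₂ d)))).1 (SphereMap.tail_eq_iff.1 h))

theorem isProper (h : Δ.IsProper) : s.diagram.IsProper := by
  obtain ⟨h1, h2, h3⟩ := h
  refine ⟨fun x y hx hy hxy => Subtype.ext ?_, fun x y hx hy hxy => Subtype.ext ?_, ?_⟩
  · exact h1 _ _ (s.face_eq_inner_iff.1 hx) (s.face_eq_inner_iff.1 hy) (s.tail_val hxy)
  · exact h2 _ _ (s.face_eq_outer_iff.1 hx) (s.face_eq_outer_iff.1 hy) (s.tail_val hxy)
  · rintro v ⟨⟨x, rfl, hx⟩, ⟨y, hxy, hy⟩⟩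
    exact h3 _ ⟨⟨_, rfl, s.face_eq_inner_iff.1 hx⟩, ⟨_, s.tail_val hxy, s.face_eq_outer_iff.1 hy⟩⟩

/-- New cells inject into old ones by sending a cell to the old cell of a representative dart, taken
in `S₁` whenever possible. Seam cells then go to inner bond cells, and the cell of `e b` is missed.
-/
theorem area_lt : s.diagram.area < Δ.area := by
  have hrep : ∀ f : s.map.Face, ∃ x, s.map.face x = f ∧
      ((∃ y, s.map.face y = f ∧ s.val y ∈ S₁) → s.val x ∈ S₁) := by
    intro f
    by_cases h : ∃ y, s.map.face y = f ∧ s.val y ∈ S₁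
    · obtain ⟨y, h1, h2⟩ := h
      exact ⟨y, h1, fun _ => h2⟩
    · obtain ⟨x, rfl⟩ := Quotient.exists_rep f
      exact ⟨x, rfl, fun h' => absurd h' h⟩
  choose rep hrep1 hrep2 using hrep
  have hpure : ∀ f, s.val (rep f) ∉ S₁ → ∀ b, ¬ s.glue.next.SameCycle (s.ofBond b) (rep f) :=
    fun f hf b hb => hf (hrep2 f ⟨s.ofBond b, (s.map_face_eq_iff.2 hb).trans (hrep1 f), b.2.1⟩)
  have hinj : ∀ f f', Δ.face (s.val (rep f)) = Δ.face (s.val (rep f')) → f = f' := by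
    intro f f' h
    rw [← hrep1 f, ← hrep1 f', s.map_face_eq_iff]
    by_cases h1 : s.val (rep f) ∈ S₁ <;> by_cases h2 : s.val (rep f') ∈ S₁
    · exact s.sameCycle_of_mem_mem h1 h2 (SphereMap.face_eq_iff.1 h)
    · exact absurd h (s.separated _ h1 _ ((rep f').2.resolve_left h2))
    · exact absurd h.symm (s.separated _ h2 _ ((rep f).2.resolve_left h1))
    · exact (s.sameCycle_val_of_forall (hpure f h1)).2 (SphereMap.face_eq_iff.1 h)
  let b : Δ.toRotationSystem.bond S₁ := ⟨_, s.nonempty.some_mem⟩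
  have hmiss : ∀ f, Δ.face (s.val (rep f)) ≠ Δ.face (s.e b).1 := by
    intro f h
    by_cases h1 : s.val (rep f) ∈ S₁
    · refine s.separated _ h1 (Δ.toRotationSystem.next (s.e b).1) ?_
        (h.trans (SphereMap.face_next _).symm)
      rw [s.inv₂.next_iff]
      exact (s.e b).2.2
    · exact hpure f h1 b (s.sameCycle_ofBond_of_notMem ((rep f).2.resolve_left h1)
        (SphereMap.face_eq_iff.1 h.symm))
  let φ : {f : s.diagram.Face // f ≠ s.diagram.inner ∧ f ≠ s.diagram.outer} →
      {f : Δ.Face // f ≠ Δ.inner ∧ f ≠ Δ.outer} := fun f =>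
    ⟨Δ.face (s.val (rep f.1)), fun h => f.2.1 ((hrep1 f.1).symm.trans (s.face_eq_inner_iff.2 h)),
      fun h => f.2.2 ((hrep1 f.1).symm.trans (s.face_eq_outer_iff.2 h))⟩
  have := Fintype.ofFinite Δ.Face
  have := Fintype.ofFinite s.diagram.Face
  classical
  unfold area
  rw [Nat.card_eq_fintype_card, Nat.card_eq_fintype_card]
  refine Fintype.card_lt_of_injective_not_surjective φ ?_ ?_
  · intro f f' h
    exact Subtype.ext (hinj _ _ (congrArg Subtype.val h))
  · intro h
    obtain ⟨f, hf⟩ := h ⟨Δ.face (s.e b).1, s.face_e_ne b⟩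
    exact hmiss f.1 (congrArg Subtype.val hf)

/-- A minimal diagram cannot be cut along two equally labelled bonds. -/
theorem not_minimal (s : Δ.Splice S₁ S₂) : ¬ (Δ.IsMinimal ∨ Δ.IsMinimalProper) := by
  rintro (h | h)
  · exact absurd (h _ s.sameBoundaryLabels) (not_le.2 s.area_lt)
  · exact absurd (h.2 _ (s.isProper h.1) s.sameBoundaryLabels) (not_le.2 s.area_lt)

end Splice

end AnnularDiagram

/-! ### Level curves of an annular diagram -/

namespace RotationSystem

variable {D : Type*} (G : RotationSystem D)

/-- The darts that can be reached from `I` without meeting a vertex of `B`. -/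
def component (B I : Set D) : Set D :=
  {d | ∀ T : Set D, G.Invariant T → (∀ a ∈ T, G.rev a ∉ B → G.rev a ∈ T) → I ⊆ T → d ∈ T}

variable {G} {B B' I : Set D}

theorem subset_component : I ⊆ G.component B I := fun _ hd _ _ _ hI => hI hd

theorem component_invariant : G.Invariant (G.component B I) := fun d =>
  ⟨fun h T h1 h2 h3 => (h1 d).1 (h T h1 h2 h3), fun h T h1 h2 h3 => (h1 d).2 (h T h1 h2 h3)⟩

theorem rev_mem_component {a : D} (ha : a ∈ G.component B I) (hB : G.rev a ∉ B) :
    G.rev a ∈ G.component B I :=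
  fun T h1 h2 h3 => h2 a (ha T h1 h2 h3) hB

theorem component_disjoint (hB : G.Invariant B) (hI : ∀ d ∈ I, d ∉ B) {d : D}
    (hd : d ∈ G.component B I) : d ∉ B :=
  hd Bᶜ hB.compl (fun _ _ h => h) hI

theorem component_anti (h : B ⊆ B') : G.component B' I ⊆ G.component B I :=
  fun _ hd T h1 h2 h3 => hd T h1 (fun a ha hB => h2 a ha fun h' => hB (h h')) h3

theorem rev_mem_of_mem_bond_component {d : D} (hd : d ∈ G.bond (G.component B I)) :
    G.rev d ∈ B :=
  not_not.1 fun h => hd.2 (rev_mem_component hd.1 h)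

/-- The set `I` is a face contour, hence connected, and everything in the component is reached from
it. -/
theorem component_conn [Finite D] (hI : ∀ d ∈ I, G.next d ∈ I)
    (hI' : ∀ a ∈ I, ∀ b ∈ I, G.next.SameCycle a b) (hne : I.Nonempty) :
    G.Conn (G.component B I) := by
  have key : ∀ T : Set D, G.Invariant T →
      (∀ d ∈ G.component B I, G.rev d ∈ G.component B I → d ∈ T → G.rev d ∈ T) →
      hne.some ∈ T → G.component B I ⊆ T := by
    intro T hT hrev h0
    have hIT : ∀ n, G.next^[n] hne.some ∈ I ∧ G.next^[n] hne.some ∈ T := by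
      intro n
      induction n with
      | zero => exact ⟨hne.some_mem, h0⟩
      | succ n ih =>
        rw [Function.iterate_succ_apply', hT.next_iff]
        have h1 := hI _ ih.1
        exact ⟨h1, hrev _ (subset_component ih.1)
          ((component_invariant.next_iff _).1 (subset_component h1)) ih.2⟩
    intro d hd
    refine (hd (T ∩ G.component B I) (fun d => ?_) (fun a ha hB => ?_) fun a ha => ?_).1
    · exact and_congr (hT d) (component_invariant d)
    · have := rev_mem_component ha.2 hB
      exact ⟨hrev a ha.2 this ha.1, this⟩
    · obtain ⟨n, rfl⟩ := (hI' _ hne.some_mem a ha).exists_iterate_eq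
      exact ⟨(hIT n).2, subset_component ha⟩
  intro T hT hrev
  by_cases h0 : hne.some ∈ T
  · exact Or.inl (key T hT hrev h0)
  · refine Or.inr (key Tᶜ hT.compl (fun d h1 h2 h3 h4 => h3 ?_) h0)
    rw [← G.rev_rev d]
    exact hrev _ h2 (by rwa [G.rev_rev]) h4

/-- All edges leaving the component end in the connected set `B`. As the graph is connected, any
other piece of the complement must be attached to `B`. -/
theorem component_compl_conn (hc : G.Conn Set.univ) (hB : G.Invariant B) (hBc : G.Conn B)
    (hI : ∀ d ∈ I, d ∉ B) (hne : I.Nonempty) : G.Conn (G.component B I)ᶜ := by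
  have hsub : B ⊆ (G.component B I)ᶜ := fun d hd h => component_disjoint hB hI h hd
  have key : ∀ T : Set D, G.Invariant T →
      (∀ d ∈ (G.component B I)ᶜ, G.rev d ∈ (G.component B I)ᶜ → d ∈ T → G.rev d ∈ T) →
      B ⊆ T → (G.component B I)ᶜ ⊆ T := by
    intro T hT hrev hBT
    have := hc (T ∪ G.component B I) (fun d => or_congr (hT d) (component_invariant d))
      (fun d _ _ hd => by
        by_contra h
        rw [Set.mem_union, not_or] at h
        by_cases h1 : d ∈ G.component B I
        · exact h.1 (hBT (rev_mem_of_mem_bond_component ⟨h1, h.2⟩))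
        · exact h.1 (hrev d h1 h.2 (hd.resolve_right h1)))
    rcases this with h | h
    · exact fun d hd => (h (Set.mem_univ d)).resolve_right hd
    · exact absurd (Or.inr (subset_component hne.some_mem)) (h (Set.mem_univ hne.some))
  intro T hT hrev
  rcases hBc T hT (fun d h1 h2 => hrev d (hsub h1) (hsub h2)) with h0 | h0
  · exact Or.inl (key T hT hrev h0)
  · refine Or.inr (key Tᶜ hT.compl (fun d h1 h2 h3 h4 => h3 ?_) h0)
    rw [← G.rev_rev d]
    exact hrev _ h2 (by rwa [G.rev_rev]) h4

theorem exists_mem_bond_of_sameCycle [Finite D] {S : Set D} (hS : G.Invariant S) {x y : D}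
    (hx : x ∈ S) (hy : y ∉ S) (h : G.next.SameCycle x y) :
    ∃ d ∈ G.bond S, G.next.SameCycle x d := by
  by_contra hno
  push Not at hno
  obtain ⟨n, rfl⟩ := h.exists_iterate_eq
  refine hy ?_
  clear h hy
  induction n with
  | zero => exact hx
  | succ n ih =>
    rw [Function.iterate_succ_apply', hS.next_iff]
    by_contra h
    exact hno _ ⟨ih, h⟩ (sameCycle_iterate _ _ _)

theorem bond_nonempty (hc : G.Conn Set.univ) {S : Set D} (hS : G.Invariant S) {a b : D}
    (ha : a ∈ S) (hb : b ∉ S) : (G.bond S).Nonempty := by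
  by_contra hno
  rw [Set.not_nonempty_iff_eq_empty] at hno
  rcases hc S hS (fun d _ _ hd => by
    by_contra h
    exact (hno ▸ (show d ∈ G.bond S from ⟨hd, h⟩) : d ∈ (∅ : Set D))) with h | h
  · exact hb (h (Set.mem_univ b))
  · exact h (Set.mem_univ a) ha

end RotationSystem

/-! ### Balls about the outer boundary component and their level curves -/

namespace AnnularDiagram

open RotationSystem

variable {X : Type*} {R : Set (GroupWord X)} (Δ : AnnularDiagram R)

/-- The darts leaving the vertices at distance at most `i` from the outer boundary component. -/
def outerBall (i : ℕ) : Set Δ.Dart :=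
  {d | ∃ w y, Δ.OnContour w Δ.outer ∧ Δ.IsPath (Δ.tail d) w y ∧ y.length ≤ i}

/-- The darts that can be reached from the inner boundary component without meeting a vertex at
distance at most `i` from the outer one. -/
def innerSide (i : ℕ) : Set Δ.Dart :=
  Δ.toRotationSystem.component (Δ.outerBall i) {d | Δ.face d = Δ.inner}

variable {Δ}

theorem tail_rot (d : Δ.Dart) : Δ.tail (Δ.rot d) = Δ.tail d := RotationSystem.mk_perm Δ.rot d

theorem outerBall_invariant (i : ℕ) : Δ.toRotationSystem.Invariant (Δ.outerBall i) := fun d => by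
  have : Δ.tail (Δ.toRotationSystem.rot d) = Δ.tail d := tail_rot d
  simp only [outerBall, Set.mem_ofPred_eq, this]

theorem outerBall_mono {i j : ℕ} (h : i ≤ j) : Δ.outerBall i ⊆ Δ.outerBall j := by
  rintro d ⟨w, y, h1, h2, h3⟩
  exact ⟨w, y, h1, h2, h3.trans h⟩

theorem mem_outerBall_of_outer {d : Δ.Dart} (h : Δ.face d = Δ.outer) (i : ℕ) :
    d ∈ Δ.outerBall i :=
  ⟨Δ.tail d, [], ⟨d, rfl, h⟩, rfl, Nat.zero_le i⟩

theorem mem_outerBall_succ {d : Δ.Dart} {i : ℕ} (h : Δ.rev d ∈ Δ.outerBall i) :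
    d ∈ Δ.outerBall (i + 1) := by
  obtain ⟨w, y, h1, h2, h3⟩ := h
  exact ⟨w, d :: y, h1, ⟨rfl, h2⟩, by simpa using h3⟩

theorem mem_outerBall_of_iterate {d : Δ.Dart} {i k : ℕ}
    (h : Δ.toRotationSystem.next^[k] d ∈ Δ.outerBall i) : d ∈ Δ.outerBall (i + k) := by
  induction k generalizing d with
  | zero => exact h
  | succ k ih =>
    have := ih h
    rw [(outerBall_invariant _).next_iff] at this
    exact mem_outerBall_succ this

/-- A path of length at most `i` to the outer contour stays in the ball, and so does that contour.
-/
theorem outerBall_conn (i : ℕ) : Δ.toRotationSystem.Conn (Δ.outerBall i) := by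
  obtain ⟨o, ho⟩ := Δ.exists_face_eq Δ.outer
  have hstep : ∀ d, Δ.face d = Δ.outer → Δ.face (Δ.toRotationSystem.next d) = Δ.outer :=
    fun d hd => (SphereMap.face_next d).trans hd
  have key : ∀ T : Set Δ.Dart, Δ.toRotationSystem.Invariant T →
      (∀ d ∈ Δ.outerBall i, Δ.rev d ∈ Δ.outerBall i → d ∈ T → Δ.rev d ∈ T) → o ∈ T →
      Δ.outerBall i ⊆ T := by
    intro T hT hrev ho'
    have htail : ∀ {a b : Δ.Dart}, Δ.tail a = Δ.tail b → a ∈ T → b ∈ T := by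
      intro a b hab ha
      have := eq_of_sameCycle (h := (· ∈ T)) (fun d => propext (hT d)) (SphereMap.tail_eq_iff.1 hab)
      exact this ▸ ha
    have hout : ∀ d, Δ.face d = Δ.outer → d ∈ T := by
      intro d hd
      obtain ⟨n, rfl⟩ := (SphereMap.face_eq_iff.1 (ho.trans hd.symm)).exists_iterate_eq
      clear hd
      suffices h : Δ.face (Δ.toRotationSystem.next^[n] o) = Δ.outer ∧
          Δ.toRotationSystem.next^[n] o ∈ T from h.2
      induction n with
      | zero => exact ⟨ho, ho'⟩
      | succ n ih =>
        rw [Function.iterate_succ_apply', hT.next_iff]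
        have h1 := hstep _ ih.1
        exact ⟨h1, hrev _ (mem_outerBall_of_outer ih.1 i)
          (((outerBall_invariant i).next_iff _).1 (mem_outerBall_of_outer h1 i)) ih.2⟩
    have hpath : ∀ (y : List Δ.Dart) (v w : Δ.Vertex), Δ.OnContour w Δ.outer → Δ.IsPath v w y →
        y.length ≤ i → ∀ d, Δ.tail d = v → d ∈ T := by
      intro y
      induction y with
      | nil =>
        rintro v w ⟨e, he, hf⟩ (rfl : v = w) - d hd
        exact htail (he.trans hd.symm) (hout e hf)
      | cons e y ih =>
        rintro v w hw ⟨h1, h2⟩ hlen d hd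
        rw [List.length_cons] at hlen
        have h3 := ih (Δ.head e) w hw h2 (by omega) (Δ.rev e) rfl
        have h4 : Δ.rev e ∈ Δ.outerBall i := ⟨w, y, hw, h2, by omega⟩
        have h5 : e ∈ Δ.outerBall i := ⟨w, e :: y, hw, ⟨rfl, h2⟩, by simpa using hlen⟩
        refine htail (h1.trans hd.symm) ?_
        rw [← Δ.rev_rev e]
        exact hrev _ h4 (by rwa [Δ.rev_rev]) h3
    rintro d ⟨w, y, h1, h2, h3⟩
    exact hpath y _ w h1 h2 h3 d rfl
  intro T hT hrev
  by_cases h0 : o ∈ T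
  · exact Or.inl (key T hT hrev h0)
  · refine Or.inr (key Tᶜ hT.compl (fun d h1 h2 h3 h4 => h3 ?_) h0)
    rw [← Δ.rev_rev d]
    exact hrev _ h2 (by rwa [← Δ.rev_rev d] at h1) h4

theorem innerSide_invariant (i : ℕ) : Δ.toRotationSystem.Invariant (Δ.innerSide i) :=
  component_invariant

theorem innerSide_anti {i j : ℕ} (h : i ≤ j) : Δ.innerSide j ⊆ Δ.innerSide i :=
  component_anti (outerBall_mono h)

theorem inner_mem_innerSide {d : Δ.Dart} (h : Δ.face d = Δ.inner) (i : ℕ) : d ∈ Δ.innerSide i :=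
  subset_component h

theorem innerSide_conn (i : ℕ) : Δ.toRotationSystem.Conn (Δ.innerSide i) :=
  component_conn (fun d hd => (SphereMap.face_next d).trans hd)
    (fun _ ha _ hb => SphereMap.face_eq_iff.1 (Eq.trans ha (Eq.symm hb))) (Δ.exists_face_eq _)

section Shortest

variable {x : List Δ.Dart} {i : ℕ}

theorem inner_notMem_outerBall (hx : Δ.IsShortestConnecting x) (hi : i < x.length)
    {d : Δ.Dart} (hd : Δ.face d = Δ.inner) : d ∉ Δ.outerBall i := by
  rintro ⟨w, y, h1, h2, h3⟩
  have := hx.2 y ⟨Δ.tail d, w, ⟨d, rfl, hd⟩, h1, h2⟩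
  omega

theorem innerSide_disjoint (hx : Δ.IsShortestConnecting x) (hi : i < x.length)
    {d : Δ.Dart} (hd : d ∈ Δ.innerSide i) : d ∉ Δ.outerBall i :=
  component_disjoint (outerBall_invariant i) (fun _ h => inner_notMem_outerBall hx hi h) hd

theorem outer_notMem_innerSide (hx : Δ.IsShortestConnecting x) (hi : i < x.length)
    {d : Δ.Dart} (hd : Δ.face d = Δ.outer) : d ∉ Δ.innerSide i :=
  fun h => innerSide_disjoint hx hi h (mem_outerBall_of_outer hd i)

theorem innerSide_compl_conn (hx : Δ.IsShortestConnecting x) (hi : i < x.length) :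
    Δ.toRotationSystem.Conn (Δ.innerSide i)ᶜ :=
  component_compl_conn Δ.toRotationSystem_conn (outerBall_invariant i) (outerBall_conn i)
    (fun _ h => inner_notMem_outerBall hx hi h) (Δ.exists_face_eq _)

theorem bond_innerSide_nonempty (hx : Δ.IsShortestConnecting x) (hi : i < x.length) :
    (Δ.toRotationSystem.bond (Δ.innerSide i)).Nonempty := by
  obtain ⟨a, ha⟩ := Δ.exists_face_eq Δ.inner
  obtain ⟨b, hb⟩ := Δ.exists_face_eq Δ.outer
  exact bond_nonempty Δ.toRotationSystem_conn (innerSide_invariant i) (inner_mem_innerSide ha i)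
    (outer_notMem_innerSide hx hi hb)

theorem face_ne_of_mem_bond_innerSide (hx : Δ.IsShortestConnecting x) (hi : i < x.length)
    {d : Δ.Dart}
    (hd : d ∈ Δ.toRotationSystem.bond (Δ.innerSide i)) :
    Δ.face d ≠ Δ.inner ∧ Δ.face d ≠ Δ.outer :=
  face_ne_of_mem_bond (innerSide_invariant i) (fun _ h => inner_mem_innerSide h i)
    (fun _ h => outer_notMem_innerSide hx hi h) hd

/-- A dart of the `i`-th bond starts at distance at most `i + 1`, too close to belong to `innerSide
j`. -/
theorem bond_innerSide_disjoint (hx : Δ.IsShortestConnecting x)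
    {j : ℕ} (hij : i < j) (hj : j < x.length) {d : Δ.Dart}
    (hd : d ∈ Δ.toRotationSystem.bond (Δ.innerSide i)) :
    d ∉ Δ.toRotationSystem.bond (Δ.innerSide j) := fun hd' =>
  innerSide_disjoint hx hj hd'.1
    (outerBall_mono hij (mem_outerBall_succ (rev_mem_of_mem_bond_component hd)))

/-- A common face would be left by both bonds, hence be a cell. From a vertex beyond distance `j`
its contour would reach distance at most `i` in fewer than `L` steps. -/
theorem innerSide_separated (hx : Δ.IsShortestConnecting x)
    {L : ℕ}
    (hL : ∀ d, Δ.face d ≠ Δ.inner → Δ.face d ≠ Δ.outer → Function.minimalPeriod Δ.next d ≤ L)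
    {j : ℕ} (hij : i + L ≤ j) (hj : j < x.length) {a b : Δ.Dart} (ha : a ∈ Δ.innerSide j)
    (hb : b ∉ Δ.innerSide i) : Δ.face a ≠ Δ.face b := by
  intro hab
  have hab := SphereMap.face_eq_iff.1 hab
  have hsub : Δ.innerSide j ⊆ Δ.innerSide i := innerSide_anti (by omega)
  obtain ⟨d, hd, had⟩ := exists_mem_bond_of_sameCycle (innerSide_invariant j) ha
    (fun h => hb (hsub h)) hab
  obtain ⟨e, he, hae⟩ := exists_mem_bond_of_sameCycle (innerSide_invariant i) (hsub ha) hb hab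
  have h1 : Δ.toRotationSystem.next e ∈ Δ.outerBall i := by
    rw [(outerBall_invariant i).next_iff]
    exact rev_mem_of_mem_bond_component he
  obtain ⟨k, hk, hke⟩ := exists_iterate_lt_of_sameCycle
    ((had.symm.trans hae).trans (Equiv.Perm.sameCycle_apply_right.2
      (Equiv.Perm.SameCycle.refl Δ.toRotationSystem.next e)))
  rw [← hke] at h1
  have hcell := face_ne_of_mem_bond_innerSide hx hj hd
  have hkL : k < L := lt_of_lt_of_le hk (hL d hcell.1 hcell.2)
  exact innerSide_disjoint hx hj hd.1 (outerBall_mono (by omega) (mem_outerBall_of_iterate h1))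

end Shortest

theorem minimalPeriod_le {L : ℕ} (hL : ∀ r ∈ R, r.length ≤ L) (d : Δ.Dart)
    (h1 : Δ.face d ≠ Δ.inner) (h2 : Δ.face d ≠ Δ.outer) :
    Function.minimalPeriod Δ.next d ≤ L := by
  obtain ⟨r, hr, h⟩ := Δ.cell_label d h1 h2
  have hlen : ∀ c : Cycle (X × Bool), (Function.periodicOrbit Δ.next d).map Δ.label = c →
      Function.minimalPeriod Δ.next d = c.length := by
    rintro _ rfl
    rw [Function.periodicOrbit_def, Cycle.map_coe, Cycle.length_coe]
    simp
  rcases h with h | h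
  · rw [hlen _ h, Cycle.length_coe]
    exact hL r hr
  · rw [hlen _ h, Cycle.length_coe, FreeGroup.invRev_length]
    exact hL r hr

theorem card_cell_darts_le [Fintype Δ.Dart] {L : ℕ} (hL : ∀ r ∈ R, r.length ≤ L)
    (s : Finset Δ.Dart) (hs : ∀ d ∈ s, Δ.face d ≠ Δ.inner ∧ Δ.face d ≠ Δ.outer) :
    s.card ≤ L * Δ.area := by
  classical
  have := Fintype.ofFinite Δ.Face
  have h1 : s.card ≤ L * (s.image Δ.face).card := by
    refine Finset.card_le_mul_card_image s L fun f hf => ?_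
    obtain ⟨d, hd, rfl⟩ := Finset.mem_image.1 hf
    refine le_trans (Finset.card_le_card (t := (Finset.range L).image fun k =>
      Δ.toRotationSystem.next^[k] d) fun e he => ?_)
      (Finset.card_image_le.trans (Finset.card_range L).le)
    rw [Finset.mem_filter] at he
    obtain ⟨k, hk, rfl⟩ := exists_iterate_lt_of_sameCycle (SphereMap.face_eq_iff.1 he.2.symm)
    exact Finset.mem_image.2 ⟨k, Finset.mem_range.2 (lt_of_lt_of_le hk
      (minimalPeriod_le hL d (hs d hd).1 (hs d hd).2)), rfl⟩
  refine h1.trans (Nat.mul_le_mul_left L ?_)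
  rw [area, Nat.card_eq_fintype_card, Fintype.card_subtype]
  refine Finset.card_le_card fun f hf => ?_
  obtain ⟨d, hd, rfl⟩ := Finset.mem_image.1 hf
  simpa using hs d hd

end AnnularDiagram

/-! ### Counting words and the main theorem -/

/-- Pairwise distinct nonempty words over a finite alphabet satisfy a Kraft-type inequality. -/
theorem sum_pow_length_le_one {κ : Type*} [Fintype κ] [Nonempty κ] {n : ℕ} {w : ℕ → List κ}
    (hw : Set.InjOn w (Finset.range n)) (hne : ∀ i < n, w i ≠ []) :
    ∑ i ∈ Finset.range n, ((2 * Fintype.card κ : ℝ)⁻¹) ^ (w i).length ≤ 1 := by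
  classical
  set q : ℝ := (2 * Fintype.card κ : ℝ)⁻¹
  have hK : (0 : ℝ) < Fintype.card κ := by exact_mod_cast Fintype.card_pos
  have hq : 0 ≤ q := by positivity
  set I := (Finset.range n).image w
  obtain ⟨T, hT⟩ : ∃ T, ∀ v ∈ I, v.length < T :=
    ⟨I.sup List.length + 1, fun v hv => Nat.lt_succ_of_le (Finset.le_sup (f := List.length) hv)⟩
  have h1 : ∑ i ∈ Finset.range n, q ^ (w i).length = ∑ v ∈ I, q ^ v.length :=
    (Finset.sum_image (f := fun v : List κ => q ^ v.length) hw).symm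
  have hpos : ∀ v ∈ I, 1 ≤ v.length := by
    intro v hv
    obtain ⟨i, hi, rfl⟩ := Finset.mem_image.1 hv
    exact List.length_pos_iff.2 (hne i (Finset.mem_range.1 hi))
  have hcard : ∀ t, ({v ∈ I | v.length = t} : Finset (List κ)).card ≤ Fintype.card κ ^ t := by
    intro t
    rw [← card_vector t, ← Finset.card_univ]
    refine le_trans (Finset.card_le_card (t := (Finset.univ : Finset (List.Vector κ t)).image
      List.Vector.toList) fun v hv => ?_) Finset.card_image_le
    exact Finset.mem_image.2 ⟨⟨v, (Finset.mem_filter.1 hv).2⟩, Finset.mem_univ _, rfl⟩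
  rw [h1, ← Finset.sum_fiberwise_of_maps_to (t := Finset.Ico 1 (T + 1)) (g := List.length)
    fun v hv => Finset.mem_Ico.2 ⟨hpos v hv, (hT v hv).trans (Nat.lt_succ_self T)⟩]
  -- The factor 2 in `q` turns the count of words of length `t` into a geometric series, whose sum
  -- from `t = 1` is below 1.
  have h2 : ∀ t ∈ Finset.Ico 1 (T + 1), ∑ v ∈ I with v.length = t, q ^ v.length ≤ (1 / 2 : ℝ) ^ t := by
    intro t _
    calc ∑ v ∈ I with v.length = t, q ^ v.length = ∑ v ∈ I with v.length = t, q ^ t :=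
          Finset.sum_congr rfl fun v hv => by rw [(Finset.mem_filter.1 hv).2]
      _ = ({v ∈ I | v.length = t} : Finset (List κ)).card * q ^ t := by
          rw [Finset.sum_const, nsmul_eq_mul]
      _ ≤ (Fintype.card κ : ℝ) ^ t * q ^ t := by
          gcongr
          exact_mod_cast hcard t
      _ = (1 / 2 : ℝ) ^ t := by
          rw [← mul_pow]
          congr 1
          simp only [q]
          field_simp
  refine (Finset.sum_le_sum h2).trans ?_
  have h3 : ∀ T : ℕ, ∑ t ∈ Finset.Ico 1 (T + 1), (1 / 2 : ℝ) ^ t = 1 - (1 / 2) ^ T := by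
    intro T
    induction T with
    | zero => simp
    | succ T ih =>
      rw [Finset.sum_Ico_succ_top (by omega), ih]
      ring
  rw [h3]
  have : (0 : ℝ) ≤ (1 / 2) ^ T := by positivity
  linarith

/-- The total length of `n` distinct nonempty words over a finite alphabet is at least of the order
of `n log n`. -/
theorem mul_log_le_sum_length {κ : Type*} [Fintype κ] [Nonempty κ] {n : ℕ} {w : ℕ → List κ}
    (hw : Set.InjOn w (Finset.range n)) (hne : ∀ i < n, w i ≠ []) :
    (n : ℝ) * Real.log n ≤
      Real.log (2 * Fintype.card κ) * (∑ i ∈ Finset.range n, (w i).length : ℕ) := by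
  rcases Nat.eq_zero_or_pos n with rfl | hn
  · simp
  have hn' : (0 : ℝ) < n := by exact_mod_cast hn
  have hK : (0 : ℝ) < 2 * Fintype.card κ := by
    have : (0 : ℝ) < Fintype.card κ := by exact_mod_cast Fintype.card_pos
    linarith
  have h1 := sum_pow_length_le_one hw hne
  set c := Real.log (2 * Fintype.card κ)
  -- The tangent line inequality for `exp` at `log n - c * length`; summed against the Kraft bound
  -- it takes the place of Jensen's inequality.
  have h2 : ∀ i ∈ Finset.range n, 1 + Real.log n - c * (w i).length ≤
      n * ((2 * Fintype.card κ : ℝ)⁻¹) ^ (w i).length := by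
    intro i _
    have e : (n : ℝ) * ((2 * Fintype.card κ : ℝ)⁻¹) ^ (w i).length =
        Real.exp (Real.log n - c * (w i).length) := by
      rw [Real.exp_sub, Real.exp_log hn', mul_comm c, Real.exp_nat_mul, Real.exp_log hK, inv_pow]
      rfl
    rw [e]
    linarith [Real.add_one_le_exp (Real.log n - c * (w i).length)]
  have h3 := Finset.sum_le_sum h2
  rw [← Finset.mul_sum, Finset.sum_sub_distrib, ← Finset.mul_sum, Finset.sum_const,
    Finset.card_range, nsmul_eq_mul] at h3
  push_cast
  nlinarith [mul_le_mul_of_nonneg_left h1 hn'.le]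

theorem Equiv.Perm.bijective_iterate {α : Type*} [Finite α] (σ : Equiv.Perm α)
    (hσ : ∀ a b, σ.SameCycle a b) (a : α) :
    Function.Bijective fun k : Fin (Function.minimalPeriod σ a) => σ^[k] a := by
  have hp := Function.minimalPeriod_pos_of_mem_periodicPts (σ.injective.mem_periodicPts a)
  refine ⟨fun k l h => Fin.ext ?_, fun b => ?_⟩
  · exact (Function.iterate_eq_iterate_iff_of_lt_minimalPeriod k.2 l.2).1 h
  · obtain ⟨n, rfl⟩ := (hσ a b).exists_iterate_eq
    exact ⟨⟨n % _, Nat.mod_lt n hp⟩, Function.iterate_mod_minimalPeriod_eq⟩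

/-- The letters read along the orbit of `a` under `σ`. -/
noncomputable def orbitWord {α κ : Type*} (σ : Equiv.Perm α) (l : α → κ) (a : α) : List κ :=
  (List.range (Function.minimalPeriod σ a)).map fun k => l (σ^[k] a)

/-- Transitive permutations along which the same words are read are conjugate. -/
theorem exists_equiv_of_orbitWord_eq {α β κ : Type*} [Finite α] [Finite β] {σ : Equiv.Perm α}
    {τ : Equiv.Perm β} (hσ : ∀ a b, σ.SameCycle a b) (hτ : ∀ a b, τ.SameCycle a b) {l : α → κ}
    {m : β → κ} {a : α} {b : β} (h : orbitWord σ l a = orbitWord τ m b) :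
    ∃ e : α ≃ β, (∀ x, e (σ x) = τ (e x)) ∧ ∀ x, m (e x) = l x := by
  have hp : Function.minimalPeriod σ a = Function.minimalPeriod τ b := by
    simpa [orbitWord] using congrArg List.length h
  have hpos := Function.minimalPeriod_pos_of_mem_periodicPts (σ.injective.mem_periodicPts a)
  rw [orbitWord, orbitWord, ← hp] at h
  have hl : ∀ k < Function.minimalPeriod σ a, l (σ^[k] a) = m (τ^[k] b) := fun k hk =>
    (List.map_inj_left.1 h) k (List.mem_range.2 hk)
  let E := Equiv.ofBijective _ (σ.bijective_iterate hσ a)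
  let F := Equiv.ofBijective _ (τ.bijective_iterate hτ b)
  let e : α ≃ β := (E.symm.trans (finCongr hp)).trans F
  have he : ∀ k, e (σ^[k] a) = τ^[k] b := by
    intro k
    have h1 : σ^[k] a = E ⟨k % Function.minimalPeriod σ a, Nat.mod_lt k hpos⟩ :=
      (Function.iterate_mod_minimalPeriod_eq).symm
    rw [h1]
    simp only [e, Equiv.trans_apply, Equiv.symm_apply_apply]
    change τ^[k % Function.minimalPeriod σ a] b = _
    rw [hp]
    exact Function.iterate_mod_minimalPeriod_eq
  refine ⟨e, fun x => ?_, fun x => ?_⟩ <;> obtain ⟨k, rfl⟩ := E.surjective x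
  · change e (σ (σ^[k] a)) = τ (e (σ^[k] a))
    rw [← Function.iterate_succ_apply' σ, he, he, Function.iterate_succ_apply']
  · change m (e (σ^[k] a)) = l (σ^[k] a)
    rw [he, hl k k.2]

theorem length_orbitWord {α κ : Type*} [Fintype α] {σ : Equiv.Perm α}
    (hσ : ∀ a b, σ.SameCycle a b) (l : α → κ) (a : α) :
    (orbitWord σ l a).length = Fintype.card α := by
  rw [← Fintype.card_of_bijective (σ.bijective_iterate hσ a), Fintype.card_fin]
  simp [orbitWord]

/-! ### The words along the level curves are distinct -/

namespace AnnularDiagram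

open RotationSystem

variable {X : Type*} {R : Set (GroupWord X)} {Δ : AnnularDiagram R}

/-- The letters of the words written along the level curves: the contour of a cell read from the
dart where the curve enters it, the position where the curve leaves it, and a residue class of
levels. -/
abbrev Letter (X : Type*) (L : ℕ) : Type _ :=
  {l : GroupWord X | l.length ≤ L} × Fin (L + 1) × Fin (L + 1)

theorem sum_card_bond_le [Fintype Δ.Dart] {L : ℕ} (hL : ∀ r ∈ R, r.length ≤ L)
    {x : List Δ.Dart} (hx : Δ.IsShortestConnecting x) :
    ∑ i ∈ Finset.range x.length, Nat.card (Δ.toRotationSystem.bond (Δ.innerSide i)) ≤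
      L * Δ.area := by
  classical
  have e : ∀ i, Nat.card (Δ.toRotationSystem.bond (Δ.innerSide i)) =
      (Δ.toRotationSystem.bond (Δ.innerSide i)).toFinset.card := fun i => by
    rw [Nat.card_eq_fintype_card, Set.toFinset_card]
  simp only [e]
  rw [← Finset.card_biUnion]
  · refine card_cell_darts_le hL _ fun d hd => ?_
    obtain ⟨i, hi, hd⟩ := Finset.mem_biUnion.1 hd
    exact face_ne_of_mem_bond_innerSide hx (Finset.mem_range.1 hi) (Set.mem_toFinset.1 hd)
  · intro i hi j hj hij
    rw [Finset.mem_coe, Finset.mem_range] at hi hj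
    refine Finset.disjoint_left.2 fun d hd hd' => ?_
    rw [Set.mem_toFinset] at hd hd'
    rcases lt_or_gt_of_ne hij with h | h
    · exact bond_innerSide_disjoint hx h hj hd hd'
    · exact bond_innerSide_disjoint hx h hi hd' hd

theorem splice_of_bond_equiv [Fintype Δ.Dart] {L : ℕ} (hL : ∀ r ∈ R, r.length ≤ L)
    {x : List Δ.Dart} (hx : Δ.IsShortestConnecting x) {i j : ℕ} (hij : i + L ≤ j)
    (hj : j < x.length) (hi : i < x.length)
    (e : Δ.toRotationSystem.bond (Δ.innerSide j) ≃ Δ.toRotationSystem.bond (Δ.innerSide i))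
    (hturn : ∀ b c, c.1 = Δ.toRotationSystem.turn (Δ.innerSide j) b.1 →
      (e c).1 = Δ.toRotationSystem.turn (Δ.innerSide i) (e b))
    (hrun : ∀ b, Δ.toRotationSystem.run (Δ.innerSide i) (e b) =
      Δ.toRotationSystem.run (Δ.innerSide j) b.1)
    (hword : ∀ b, Δ.contourWord (e b).1 = Δ.contourWord b.1) :
    Nonempty (Δ.Splice (Δ.innerSide j) (Δ.innerSide i)) :=
  ⟨{ acyclic := Δ.toRotationSystem_acyclic
     conn := Δ.toRotationSystem_conn
     inv₁ := innerSide_invariant j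
     inv₂ := innerSide_invariant i
     conn₁ := innerSide_conn j
     conn₁_compl := innerSide_compl_conn hx hj
     conn₂ := innerSide_conn i
     conn₂_compl := innerSide_compl_conn hx hi
     subset := innerSide_anti (by omega)
     nonempty := bond_innerSide_nonempty hx hj
     e := e
     turn_e := hturn
     run_e := hrun
     period_e := fun b => by
      have h : Function.minimalPeriod Δ.next (e b).1 = Function.minimalPeriod Δ.next b.1 := by
        simpa [contourWord] using congrArg List.length (hword b)
      exact h
     inner_mem := fun d hd => inner_mem_innerSide hd j
     outer_notMem := fun d hd => outer_notMem_innerSide hx hi hd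
     separated := fun a ha b hb =>
      innerSide_separated hx (fun d => minimalPeriod_le hL d) hij hj ha hb
     contourWord_e := hword }⟩

theorem mul_log_le {L : ℕ} [Fintype (Letter X L)] [Nonempty (Letter X L)]
    (hL : ∀ r ∈ R, r.length ≤ L) (hmin : Δ.IsMinimal ∨ Δ.IsMinimalProper) {x : List Δ.Dart}
    (hx : Δ.IsShortestConnecting x) :
    (x.length : ℝ) * Real.log x.length ≤
      Real.log (2 * Fintype.card (Letter X L)) * (L * Δ.area : ℕ) := by
  classical
  have := Fintype.ofFinite Δ.Dart
  have hK : (0 : ℝ) ≤ Real.log (2 * Fintype.card (Letter X L)) := by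
    refine Real.log_nonneg ?_
    have : (1 : ℝ) ≤ Fintype.card (Letter X L) := by exact_mod_cast Fintype.card_pos
    linarith
  let P : ℕ → Set Δ.Dart := Δ.innerSide
  have hper : ∀ i < x.length, ∀ b : Δ.toRotationSystem.bond (P i),
      Function.minimalPeriod Δ.next b.1 ≤ L := fun i hi b =>
    minimalPeriod_le hL b.1 (face_ne_of_mem_bond_innerSide hx hi b.2).1
      (face_ne_of_mem_bond_innerSide hx hi b.2).2
  let letter : ∀ i, i < x.length → Δ.toRotationSystem.bond (P i) → Letter X L := fun i hi b =>
    (⟨Δ.contourWord b.1, by simpa [contourWord] using hper i hi b⟩,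
      ⟨Δ.toRotationSystem.run (P i) b.1,
        (lt_of_lt_of_le (run_lt b.2) (hper i hi b)).trans (Nat.lt_succ_self L)⟩,
      ⟨i % (L + 1), Nat.mod_lt i (Nat.succ_pos L)⟩)
  let σ : ∀ i, i < x.length → Equiv.Perm (Δ.toRotationSystem.bond (P i)) := fun i hi =>
    Δ.toRotationSystem.turnPerm (P i) Δ.toRotationSystem_acyclic (innerSide_invariant i)
      (innerSide_conn i) (innerSide_compl_conn hx hi)
  have hσ : ∀ i hi a b, (σ i hi).SameCycle a b := fun i hi =>
    turnPerm_sameCycle Δ.toRotationSystem_acyclic (innerSide_invariant i)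
      (innerSide_conn i) (innerSide_compl_conn hx hi)
  let base : ∀ i, i < x.length → Δ.toRotationSystem.bond (P i) := fun i hi =>
    ⟨_, (bond_innerSide_nonempty hx hi).some_mem⟩
  let w : ℕ → List (Letter X L) := fun i =>
    if hi : i < x.length then orbitWord (σ i hi) (letter i hi) (base i hi) else []
  have hw : ∀ i (hi : i < x.length), w i = orbitWord (σ i hi) (letter i hi) (base i hi) :=
    fun i hi => dif_pos hi
  have hlen : ∀ i, i < x.length → (w i).length = Nat.card (Δ.toRotationSystem.bond (P i)) :=
    fun i hi => by rw [hw i hi, length_orbitWord (hσ i hi), Nat.card_eq_fintype_card]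
  have hlt : ∀ i j, i < j → i < x.length → j < x.length → w i ≠ w j := by
    intro i j hij hi hj h
    rw [hw i hi, hw j hj] at h
    -- Level `j` is nearer the inner hole, so its bond plays the role of the inner seam.
    obtain ⟨e, he, hle⟩ := exists_equiv_of_orbitWord_eq (hσ j hj) (hσ i hi) h.symm
    have hmod : i % (L + 1) = j % (L + 1) :=
      congrArg (fun l : Letter X L => (l.2.2 : ℕ)) (hle (base j hj))
    -- Distinct levels with equal residues modulo `L + 1` differ by more than `L`, as separation
    -- requires.
    have hijL : i + L ≤ j := by
      have h1 : (L + 1) ∣ j - i := (Nat.modEq_iff_dvd' hij.le).1 hmod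
      have := Nat.le_of_dvd (by omega) h1
      omega
    obtain ⟨s⟩ := splice_of_bond_equiv hL hx hijL hj hi e
      (fun b c hc => by
        have : c = σ j hj b := Subtype.ext hc
        rw [this, he]
        rfl)
      (fun b => congrArg (fun l : Letter X L => (l.2.1 : ℕ)) (hle b))
      (fun b => congrArg (fun l : Letter X L => l.1.1) (hle b))
    exact s.not_minimal hmin
  have hinj : Set.InjOn w (Finset.range x.length) := by
    intro i hi j hj h
    rw [Finset.mem_coe, Finset.mem_range] at hi hj
    rcases lt_trichotomy i j with h1 | h1 | h1
    · exact absurd h (hlt i j h1 hi hj)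
    · exact h1
    · exact absurd h.symm (hlt j i h1 hj hi)
  have hne : ∀ i < x.length, w i ≠ [] := by
    intro i hi h
    have h1 := hlen i hi
    rw [h, List.length_nil, eq_comm, Nat.card_eq_fintype_card, Fintype.card_eq_zero_iff] at h1
    exact h1.false (base i hi)
  refine (mul_log_le_sum_length hinj hne).trans (mul_le_mul_of_nonneg_left ?_ hK)
  rw [Nat.cast_le, Finset.sum_congr rfl fun i hi => hlen i (Finset.mem_range.1 hi)]
  exact sum_card_bond_le hL hx

end AnnularDiagram

theorem mainTheorem6 {X : Type*} [Finite X] (R : Set (GroupWord X)) (hR : R.Finite) :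
    ∃ C : ℝ, 0 < C ∧
      ∀ Δ : AnnularDiagram R, Δ.IsMinimal ∨ Δ.IsMinimalProper →
        ∀ x : List Δ.Dart, Δ.IsShortestConnecting x →
          C * (x.length : ℝ) * Real.log (x.length : ℝ) ≤ (Δ.area : ℝ) := by
  obtain ⟨L, hL⟩ : ∃ L, ∀ r ∈ R, r.length ≤ L := by
    obtain ⟨L, hL⟩ := (hR.image List.length).bddAbove
    exact ⟨L, fun r hr => hL ⟨r, hr, rfl⟩⟩
  -- Passing to `L + 1` keeps the constant finite and positive even when the bound `L` is 0.
  have hL' : ∀ r ∈ R, r.length ≤ L + 1 := fun r hr => (hL r hr).trans (Nat.le_succ L)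
  have : Finite {l : GroupWord X | l.length ≤ L + 1} := (List.finite_length_le _ _).to_subtype
  have : Fintype (AnnularDiagram.Letter X (L + 1)) := Fintype.ofFinite _
  have : Nonempty (AnnularDiagram.Letter X (L + 1)) := ⟨(⟨[], Nat.zero_le _⟩, 0, 0)⟩
  set K := Real.log (2 * Fintype.card (AnnularDiagram.Letter X (L + 1)))
  have hK : 0 < K := by
    refine Real.log_pos ?_
    have : (1 : ℝ) ≤ Fintype.card (AnnularDiagram.Letter X (L + 1)) := by
      exact_mod_cast Fintype.card_pos
    linarith
  have hKL : 0 < K * (L + 1) := by positivity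
  refine ⟨(K * (L + 1))⁻¹, inv_pos.2 hKL, fun Δ hΔ x hx => ?_⟩
  have h := AnnularDiagram.mul_log_le hL' hΔ hx
  rw [mul_assoc, inv_mul_le_iff₀ hKL]
  push_cast at h
  linarith
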